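/- **Setting.** A graph $G$ on $V=\{0,\dots,n-1\}$, $n\ge 1$, is regarded as the set of positive edges; all other pairs of distinct vertices are negative edges. A clustering is a labelling $\mathrm{cl}:V\to\mathbb N$. Its cost is the number of unordered pairs $\{x,y\}$, $x\neq y$, that are either a positive edge with $\mathrm{cl}(x)\ne \mathrm{cl}(y)$ or a negative edge with $\mathrm{cl}(x)=\mathrm{cl}(y)$. $\mathrm{OPT}(G)$ is the minimum cost (the MinDisagree optimum). A clustering is a $(c,\varepsilon)$-approximation if its cost is at most $c\cdot \mathrm{OPT}(G)+\varepsilon n^2$. Running time is measured on a unit-cost random access machine: registers and indirectly addressed memory holding natural numbers, addition, truncated subtraction, comparisons, conditionals and loops; in unit time it can also ask whether two given vertices are joined by a positive edge, or read the next entry of a random tape $r$, whose entries are independent uniformly random vertices. A local algorithm receives $n$, the integer $\lceil 1/\varepsilon\rceil$ and one vertex $v$, has oracle access to $G$, and returns a label for $v$; with the same tape $r$ used for all $v$, these labels form the clustering it defines. A local algorithm with preprocessing first runs a program that does not see $v$, and then, from the configuration this program left, a second program that sees $v$ (and continues to read the same tape). **Theorem 3.4.** 1. There are one program and one absolute constant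 $C$ such that for all $\varepsilon\in(0,1)$, all $n\ge1$ and every graph $G$ on $n$ vertices, the program is a local algorithm that makes at most $C/\varepsilon^2$ steps for every tape and every vertex, and with probability at least $2/3$ over the tape the clustering it defines is a $(4,\varepsilon)$-approximation. 2. There are two programs (preprocessing and per-vertex) and an absolute constant $C$ such that for all $\varepsilon\in(0,1)$, all $n\ge1$ and every graph $G$ on $n$ vertices, for every tape the preprocessing makes at most $C/\varepsilon^2$ steps and at most $C/\varepsilon^2$ queries, these queries are non-adaptive (the list of queried pairs depends only on $\varepsilon$, $n$ and the tape, not on $G$), the per-vertex program then makes at most $C/\varepsilon$ steps for every vertex, and with probability at least $2/3$ over the tape the clustering defined is a $(4,\varepsilon)$-approximation. 3. For all $c\ge 1$ and $\delta>0$ there are $K>0$ and $\varepsilon_0>0$ such that for every $\varepsilon\in(0,\varepsilon_0)$ and every $p\in\mathbb N$ there is an $N$ such that for all $n\ge N$ the following holds. Consider any randomized local algorithm for graphs on $n$ vertices, with an arbitrary probability space of seeds and no restriction on computation, that in the worst case makes at most $p$ adaptive queries in a preprocessing stage common to all vertices and at most $q$ further adaptive queries for each input vertex. If for every graph $G$ on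 $n$ vertices the clustering it defines is a $(c,\varepsilon)$-approximation with probability at least $\delta$ over the seed, then $q\ge K/\varepsilon$. -/

import Mathlib

open MeasureTheory

namespace LocalClustering

/-! ### Correlation clustering

The input is the graph `G` of positive edges on the vertex set `{0, …, n - 1}`; every other pair of
distinct vertices is a negative edge.  A clustering is a labelling `Fin n → ℕ`. -/

open Classical in
/-- The cost of a clustering: the number of unordered pairs `{x, y}` of distinct vertices (listed
with `x < y`) that form a positive edge between two clusters or a negative edge inside a cluster. -/
noncomputable def disagreements {n : ℕ} (G : SimpleGraph (Fin n)) (cl : Fin n → ℕ) : ℕ :=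
  (Finset.univ.filter fun e : Fin n × Fin n =>
    e.1 < e.2 ∧ ¬ (G.Adj e.1 e.2 ↔ cl e.1 = cl e.2)).card

/-- The optimal cost for MinDisagree (a minimum over a nonempty set of natural numbers). -/
noncomputable def optCost {n : ℕ} (G : SimpleGraph (Fin n)) : ℕ :=
  sInf (Set.range (disagreements G))

/-- `cl` is a `(c, ε)`-approximate clustering of `G`. -/
def IsApproxClustering (c ε : ℝ) {n : ℕ} (G : SimpleGraph (Fin n)) (cl : Fin n → ℕ) : Prop :=
  (disagreements G cl : ℝ) ≤ c * (optCost G : ℝ) + ε * (n : ℝ) ^ 2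

/-! ### Random access machines with an adjacency oracle and a random tape -/

/-- Programs of a unit-cost random access machine.  It has registers (a program mentions finitely
many of them) and an unbounded memory addressed through registers; both hold natural numbers.
Arithmetic is restricted to addition and truncated subtraction. -/
inductive Cmd : Type
  /-- do nothing -/
  | skip : Cmd
  /-- `const r a`: register `r` receives the number `a` -/
  | const (r a : ℕ) : Cmd
  /-- `copy r x`: register `r` receives the content of register `x` -/
  | copy (r x : ℕ) : Cmd
  /-- `add r x y`: register `r` receives the sum of registers `x` and `y` -/
  | add (r x y : ℕ) : Cmd
  /-- `sub r x y`: register `r` receives the truncated difference of registers `x` and `y` -/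
  | sub (r x y : ℕ) : Cmd
  /-- `load r x`: register `r` receives the memory cell whose address is in register `x` -/
  | load (r x : ℕ) : Cmd
  /-- `store x y`: the memory cell whose address is in register `x` receives register `y` -/
  | store (x y : ℕ) : Cmd
  /-- `query r x y`: register `r` receives `1` if the vertices named in registers `x` and `y` are
  joined by a positive edge, and `0` otherwise -/
  | query (r x y : ℕ) : Cmd
  /-- `rand r`: register `r` receives the next entry of the random tape, a random vertex -/
  | rand (r : ℕ) : Cmd
  /-- sequential composition -/
  | seq (P Q : Cmd) : Cmd
  /-- `iteLt x y P Q`: run `P` if register `x` is less than register `y`, and `Q` otherwise -/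
  | iteLt (x y : ℕ) (P Q : Cmd) : Cmd
  /-- `whileLt x y P`: repeat `P` as long as register `x` is less than register `y` -/
  | whileLt (x y : ℕ) (P : Cmd) : Cmd

/-- A configuration: registers and memory, together with the number of entries read so far from the
random tape, the number of steps made so far, and the list of oracle queries made so far, the last
one first.  Programs have no access to the step counter and the query list. -/
structure State : Type where
  reg : ℕ → ℕ
  mem : ℕ → ℕ
  drawn : ℕ
  time : ℕ
  log : List (ℕ × ℕ)

/-- The configuration after one more step. -/
def State.tick (s : State) : State :=
  { s with time := s.time + 1 }

/-- The configuration after one more step, which writes `a` to register `r`. -/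
def State.set (s : State) (r a : ℕ) : State :=
  { s with reg := Function.update s.reg r a, time := s.time + 1 }

open Classical in
/-- The adjacency oracle on vertex names; names that are not below `n` have no positive edge. -/
noncomputable def oracle {n : ℕ} (G : SimpleGraph (Fin n)) (a b : ℕ) : ℕ :=
  if ∃ (ha : a < n) (hb : b < n), G.Adj ⟨a, ha⟩ ⟨b, hb⟩ then 1 else 0

/-- `Exec G ω P s s'`: with oracle access to `G` and random tape `ω`, the program `P` started in
the configuration `s` halts in the configuration `s'`.  Every instruction and every evaluation of a
test of a conditional or of a loop is one step. -/
inductive Exec {n : ℕ} (G : SimpleGraph (Fin n)) (ω : ℕ → Fin n) : Cmd → State → State → Prop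
  | skip (s : State) : Exec G ω Cmd.skip s s.tick
  | const (r a : ℕ) (s : State) : Exec G ω (Cmd.const r a) s (s.set r a)
  | copy (r x : ℕ) (s : State) : Exec G ω (Cmd.copy r x) s (s.set r (s.reg x))
  | add (r x y : ℕ) (s : State) : Exec G ω (Cmd.add r x y) s (s.set r (s.reg x + s.reg y))
  | sub (r x y : ℕ) (s : State) : Exec G ω (Cmd.sub r x y) s (s.set r (s.reg x - s.reg y))
  | load (r x : ℕ) (s : State) : Exec G ω (Cmd.load r x) s (s.set r (s.mem (s.reg x)))
  | store (x y : ℕ) (s : State) :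
      Exec G ω (Cmd.store x y) s
        { s.tick with mem := Function.update s.mem (s.reg x) (s.reg y) }
  | query (r x y : ℕ) (s : State) :
      Exec G ω (Cmd.query r x y) s
        { s.set r (oracle G (s.reg x) (s.reg y)) with log := (s.reg x, s.reg y) :: s.log }
  | rand (r : ℕ) (s : State) :
      Exec G ω (Cmd.rand r) s { s.set r (ω s.drawn : ℕ) with drawn := s.drawn + 1 }
  | seq {P Q : Cmd} {s s' s'' : State} :
      Exec G ω P s s' → Exec G ω Q s' s'' → Exec G ω (Cmd.seq P Q) s s''
  | iteLt_true {x y : ℕ} {P Q : Cmd} {s s' : State} :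
      s.reg x < s.reg y → Exec G ω P s.tick s' → Exec G ω (Cmd.iteLt x y P Q) s s'
  | iteLt_false {x y : ℕ} {P Q : Cmd} {s s' : State} :
      ¬ s.reg x < s.reg y → Exec G ω Q s.tick s' → Exec G ω (Cmd.iteLt x y P Q) s s'
  | whileLt_true {x y : ℕ} {P : Cmd} {s s' s'' : State} :
      s.reg x < s.reg y → Exec G ω P s.tick s' → Exec G ω (Cmd.whileLt x y P) s' s'' →
      Exec G ω (Cmd.whileLt x y P) s s''
  | whileLt_false {x y : ℕ} {P : Cmd} {s : State} :
      ¬ s.reg x < s.reg y → Exec G ω (Cmd.whileLt x y P) s s.tick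

/-- The machine is deterministic once the graph and the random tape are fixed, so the final
configuration and the output of a halting run are well defined. -/
theorem Exec.unique {n : ℕ} {G : SimpleGraph (Fin n)} {ω : ℕ → Fin n} {P : Cmd} {s s₁ s₂ : State}
    (h₁ : Exec G ω P s s₁) (h₂ : Exec G ω P s s₂) : s₁ = s₂ := by
  induction h₁ generalizing s₂ with
  | seq _ _ ih1 ih2 =>
    cases h₂ with
    | seq a b => obtain rfl := ih1 a; exact ih2 b
  | iteLt_true h _ ih =>
    cases h₂ with
    | iteLt_true _ a => exact ih a
    | iteLt_false h' _ => exact absurd h h'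
  | iteLt_false h _ ih =>
    cases h₂ with
    | iteLt_true h' _ => exact absurd h' h
    | iteLt_false _ a => exact ih a
  | whileLt_true h _ _ ih1 ih2 =>
    cases h₂ with
    | whileLt_true _ a b => obtain rfl := ih1 a; exact ih2 b
    | whileLt_false h' => exact absurd h h'
  | whileLt_false h =>
    cases h₂ with
    | whileLt_true h' _ _ => exact absurd h' h
    | whileLt_false _ => rfl
  | _ => cases h₂; rfl

/-- Initial configuration: register `0` holds the number `n` of vertices, register `1` holds the
accuracy parameter `k`, and everything else is `0`. -/
def State.init (n k : ℕ) : State where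
  reg := Function.update (Function.update (fun _ => 0) 0 n) 1 k
  mem := fun _ => 0
  drawn := 0
  time := 0
  log := []

/-- The configuration `s` after the input vertex `v` has been written to register `2` and the step
counter and the query list have been reset. -/
def State.giveVertex (s : State) (v : ℕ) : State :=
  { s with reg := Function.update s.reg 2 v, time := 0, log := [] }

/-- The output of a run: the content of register `0`. -/
def State.output (s : State) : ℕ := s.reg 0

/-- The law of the random tape: independent uniformly random vertices. -/
noncomputable def tapeLaw (n : ℕ) [NeZero n] : Measure (ℕ → Fin n) :=
  Measure.infinitePi fun _ : ℕ => (PMF.uniformOfFintype (Fin n)).toMeasure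

/-- On the graph `G`, with accuracy parameter `k`, the program `P` is a local algorithm that makes
at most `T` steps for every tape and every input vertex and, run with the same tape for all the
vertices, returns the labels of a `(c, ε)`-approximate clustering with probability at least `δ`. -/
def ClustersLocally (P : Cmd) (k : ℕ) (T c ε δ : ℝ) {n : ℕ} [NeZero n]
    (G : SimpleGraph (Fin n)) : Prop :=
  ∃ cl : (ℕ → Fin n) → Fin n → ℕ,
    (∀ (ω : ℕ → Fin n) (v : Fin n), ∃ s : State,
      Exec G ω P ((State.init n k).giveVertex v) s ∧ (s.time : ℝ) ≤ T ∧ s.output = cl ω v) ∧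
    δ ≤ (tapeLaw n).real {ω | IsApproxClustering c ε G (cl ω)}

/-- The same with preprocessing.  The program `Ppre` is run before the input vertex is known; it
makes at most `Tpre` steps and at most `Tpre` queries, and its list of queries is `queries ω`.  The
program `P` is started in the configuration that `Ppre` left, with the input vertex added, and
makes at most `T` steps. -/
def ClustersLocallyWithPreprocessing (Ppre P : Cmd) (k : ℕ) (Tpre T c ε δ : ℝ) {n : ℕ} [NeZero n]
    (queries : (ℕ → Fin n) → List (ℕ × ℕ)) (G : SimpleGraph (Fin n)) : Prop :=
  ∃ cl : (ℕ → Fin n) → Fin n → ℕ,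
    (∀ ω : ℕ → Fin n, ∃ s : State,
      Exec G ω Ppre (State.init n k) s ∧
      (s.time : ℝ) ≤ Tpre ∧ (s.log.length : ℝ) ≤ Tpre ∧ s.log = queries ω ∧
      ∀ v : Fin n, ∃ s' : State,
        Exec G ω P (s.giveVertex v) s' ∧ (s'.time : ℝ) ≤ T ∧ s'.output = cl ω v) ∧
    δ ≤ (tapeLaw n).real {ω | IsApproxClustering c ε G (cl ω)}

/-! ### Adaptive query algorithms, for the lower bound -/

/-- A deterministic algorithm with unlimited computational power and oracle access to a graph on
`Fin n`: each query may depend on the answers to the earlier ones. -/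
inductive QueryTree (n : ℕ) (α : Type) : Type
  | answer (a : α) : QueryTree n α
  | ask (x y : Fin n) (next : Bool → QueryTree n α) : QueryTree n α

open Classical in
/-- The answer given on the graph `G`. -/
noncomputable def QueryTree.eval {n : ℕ} {α : Type} (G : SimpleGraph (Fin n)) :
    QueryTree n α → α
  | .answer a => a
  | .ask x y next => (next (decide (G.Adj x y))).eval G

open Classical in
/-- The number of queries made on the graph `G`. -/
noncomputable def QueryTree.cost {n : ℕ} {α : Type} (G : SimpleGraph (Fin n)) :
    QueryTree n α → ℕ
  | .answer _ => 0
  | .ask x y next => (next (decide (G.Adj x y))).cost G + 1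

/-- A randomized local clustering algorithm with preprocessing for graphs on `Fin n`, with seed in
`Ω`.  For every seed, the preprocessing makes adaptive queries and then hands over, for every input
vertex, an adaptive algorithm that returns the label of that vertex. -/
abbrev LocalQueryAlgorithm (n : ℕ) (Ω : Type) : Type :=
  Ω → QueryTree n (Fin n → QueryTree n ℕ)

/-- The clustering defined by the algorithm on the graph `G` when the seed is `ω`. -/
noncomputable def LocalQueryAlgorithm.label {n : ℕ} {Ω : Type} (A : LocalQueryAlgorithm n Ω)
    (G : SimpleGraph (Fin n)) (ω : Ω) (v : Fin n) : ℕ :=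
  (((A ω).eval G) v).eval G

/-- In the worst case, the algorithm makes at most `p` queries in the preprocessing and at most `q`
queries for every input vertex. -/
def LocalQueryAlgorithm.HasQueryComplexity {n : ℕ} {Ω : Type} (A : LocalQueryAlgorithm n Ω)
    (p q : ℕ) : Prop :=
  ∀ (G : SimpleGraph (Fin n)) (ω : Ω),
    (A ω).cost G ≤ p ∧ ∀ v : Fin n, (((A ω).eval G) v).cost G ≤ q

end LocalClustering

open LocalClustering

/-!
The algorithm is pivot clustering: vertices are drawn at random, a drawn vertex that is near no
earlier pivot becomes a pivot, and every vertex joins the first pivot near it, where "near" means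
equal or joined by a positive edge.

**Quality of one clustering.**  An error caused by a new pivot `u` is a pair `x`, `y` such that
`u, x, y` is a bad triple, one with exactly two near pairs.  Every clustering, in particular an
optimal one, errs inside every bad triple, and all three vertices of an uncovered bad triple are
equally likely to be drawn.  So the settled errors plus three times the optimal errors at uncovered
pairs do not increase in expectation (`sum_potential_le`).  Positive edges among uncovered vertices
are still lost when `k` draws are over.  But if there are `e` of them, the next draw covers on
average at least `2 * e / n` vertices, and only `n` vertices can be covered, so on average at most
`n ^ 2 / (2 * k)` of them are left (`mul_drawMean_openEdges_le`).  Together the expected cost is at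
most `3 * OPT + n ^ 2 / (2 * k)` (`drawMean_disagreements_le`).

**Success probability.**  Each of a constant number of independent trials also counts the errors of
its clustering in a sample of `2048 * k` random pairs, and the trial with the smallest count is
used.  By Markov's inequality the count of a trial is small with constant probability; by
Chebyshev's inequality the count of a clustering that is not good enough is small only with tiny
probability, since its variance is at most its mean (`best_trial_good`).

**Programs.**  The candidates for pivots are stored together with a bit that tells whether they
became pivots.  The label of a vertex is computed by comparing it with all candidates, from the
last to the first, such that the first pivot near it is written last.  Since all comparisons are
made, whether or not the candidate is a pivot, the list of queries does not depend on the graph.  A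
label costs `O(k)` steps, and the preprocessing computes `O(k)` labels.

**Lower bound.**  The hard input is the union of cliques on `L ≈ 1 / (4 * ε)` random blocks, whose
optimal cost is `0`.  Fix the seed and, step by step, the blocks of the vertices that the
preprocessing asks about (`QueryTree.exists_pin`); this keeps the success probability and leaves all
but `O(p)` vertices uniformly random.  Each query of a vertex then finds an edge that is not yet
known with probability at most `1 / L`, so if `q` is much smaller than `L`, most vertices get the
label that they have on the graph of known edges.  These default labels are independent of the
random blocks.  If few pairs of default labels agree, too many pairs inside blocks are separated;
if many agree, too many pairs across blocks are joined (`few_queries_fail`).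
-/

namespace LocalClustering

/-! ### Indicators and ordered pairs -/

open Classical in
/-- The indicator of a proposition, as a real number. -/
noncomputable def ind (p : Prop) : ℝ := if p then 1 else 0

theorem ind_true {p : Prop} (h : p) : ind p = 1 := if_pos h

theorem ind_false {p : Prop} (h : ¬ p) : ind p = 0 := if_neg h

theorem ind_nonneg (p : Prop) : 0 ≤ ind p := by unfold ind; split_ifs <;> norm_num

theorem ind_le_one (p : Prop) : ind p ≤ 1 := by unfold ind; split_ifs <;> norm_num

theorem ind_mono {p q : Prop} (h : p → q) : ind p ≤ ind q := by
  by_cases hp : p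
  · rw [ind_true hp, ind_true (h hp)]
  · rw [ind_false hp]; exact ind_nonneg q

theorem ind_congr {p q : Prop} (h : p ↔ q) : ind p = ind q := by rw [propext h]

theorem ind_or_le (p q : Prop) : ind (p ∨ q) ≤ ind p + ind q := by
  by_cases hp : p
  · rw [ind_true hp]; linarith [ind_le_one (p ∨ q), ind_nonneg q]
  · rw [ind_false hp, zero_add]; exact ind_mono fun h => h.resolve_left hp

theorem ind_and (p q : Prop) : ind (p ∧ q) = ind p * ind q := by
  by_cases hp : p <;> by_cases hq : q <;> simp [ind, hp, hq]

theorem sum_ind_mem {α : Type*} [Fintype α] (B : Finset α) : ∑ w, ind (w ∈ B) = B.card := by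
  classical
  have h : ∀ w, ind (w ∈ B) = if w ∈ B then 1 else 0 := fun w => by
    by_cases h : w ∈ B <;> simp [ind, h]
  simp [h]

theorem sum_ind_eq {α : Type*} [Fintype α] (b : α) : ∑ a, ind (a = b) = 1 := by
  classical simp [ind]

/-- `x` and `y` are equal or joined by a positive edge. -/
def Near {n : ℕ} (G : SimpleGraph (Fin n)) (x y : Fin n) : Prop := x = y ∨ G.Adj x y

/-- The clustering `cl` errs on the pair `x`, `y`.  Vertices are near themselves, so a clustering
never errs on a pair `x`, `x`. -/
def Errs {n : ℕ} (G : SimpleGraph (Fin n)) (cl : Fin n → ℕ) (x y : Fin n) : Prop :=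
  ¬ (Near G x y ↔ cl x = cl y)

theorem near_comm {n : ℕ} {G : SimpleGraph (Fin n)} {x y : Fin n} : Near G x y ↔ Near G y x := by
  simp only [Near, G.adj_comm, eq_comm]

theorem errs_comm {n : ℕ} {G : SimpleGraph (Fin n)} {cl : Fin n → ℕ} {x y : Fin n} :
    Errs G cl x y ↔ Errs G cl y x := by
  simp only [Errs, near_comm (x := x), eq_comm (a := cl x)]

theorem not_errs_self {n : ℕ} {G : SimpleGraph (Fin n)} {cl : Fin n → ℕ} {x : Fin n} :
    ¬ Errs G cl x x := by simp [Errs, Near]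

/-- Every erroneous unordered pair is counted twice among the ordered pairs. -/
theorem two_mul_disagreements {n : ℕ} (G : SimpleGraph (Fin n)) (cl : Fin n → ℕ) :
    2 * (disagreements G cl : ℝ) = ∑ x, ∑ y, ind (Errs G cl x y) := by
  have h : ∀ x y, ind (Errs G cl x y)
      = ind (x < y ∧ Errs G cl x y) + ind (y < x ∧ Errs G cl y x) := by
    intro x y
    rcases lt_trichotomy x y with h | rfl | h
    · rw [ind_false (p := y < x ∧ _) fun h' => h.not_gt h'.1, add_zero]
      exact ind_congr (by simp [h])
    · simp [ind, not_errs_self]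
    · rw [ind_false (p := x < y ∧ _) fun h' => h.not_gt h'.1, zero_add]
      exact ind_congr (by simp [h, errs_comm (x := x)])
  have h1 : (disagreements G cl : ℝ)
      = ∑ x, ∑ y, ind (x < y ∧ Errs G cl x y) := by
    classical
    rw [disagreements, Finset.card_filter, Fintype.sum_prod_type]
    push_cast
    refine Finset.sum_congr rfl fun x _ => Finset.sum_congr rfl fun y _ => ?_
    by_cases hxy : x < y
    · simp [ind, hxy, hxy.ne, Errs, Near]
    · simp [ind, hxy]
  simp_rw [h, Finset.sum_add_distrib]
  rw [Finset.sum_comm (f := fun x y => ind (y < x ∧ Errs G cl y x)), ← h1]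
  ring

/-! ### Random unions of cliques -/

section LowerBound

variable {n L : ℕ}

/-- The disjoint union of the cliques on the fibres of `φ`. -/
def blockGraph (φ : Fin n → Fin L) : SimpleGraph (Fin n) where
  Adj x y := x ≠ y ∧ φ x = φ y
  symm := ⟨fun _ _ h => ⟨h.1.symm, h.2.symm⟩⟩
  loopless := ⟨fun _ h => h.1 rfl⟩

/-- The map that agrees with `ψ` on `W` and with `φ` elsewhere.  For uniformly random `φ` it has
the law of a uniformly random map conditioned on its values on `W`. -/
def pin (W : Finset (Fin n)) (ψ φ : Fin n → Fin L) : Fin n → Fin L :=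
  fun v => if v ∈ W then ψ v else φ v

/-- The part of the block graph that is known once the values on `W` are known. -/
def pinnedGraph (W : Finset (Fin n)) (ψ : Fin n → Fin L) : SimpleGraph (Fin n) where
  Adj x y := x ≠ y ∧ x ∈ W ∧ y ∈ W ∧ ψ x = ψ y
  symm := ⟨fun _ _ h => ⟨h.1.symm, h.2.2.1, h.2.1, h.2.2.2.symm⟩⟩
  loopless := ⟨fun _ h => h.1 rfl⟩

theorem near_blockGraph {φ : Fin n → Fin L} {x y : Fin n} :
    Near (blockGraph φ) x y ↔ φ x = φ y := by
  simp only [Near, blockGraph]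
  by_cases h : x = y <;> simp [h]

theorem optCost_blockGraph (φ : Fin n → Fin L) : optCost (blockGraph φ) = 0 := by
  refine Nat.le_zero.1 (Nat.sInf_le ⟨fun v => (φ v : ℕ), ?_⟩)
  have h := two_mul_disagreements (blockGraph φ) (fun v => (φ v : ℕ))
  simp only [Errs, near_blockGraph, Fin.val_inj, not_true_eq_false, ind_false not_false,
    Finset.sum_const_zero] at h
  have : (disagreements (blockGraph φ) (fun v => (φ v : ℕ)) : ℝ) = 0 := by linarith
  exact_mod_cast this

/-- Replacing one value of a uniformly random map by a uniformly random value does not change its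
law. -/
theorem sum_resample (x : Fin n) (f : (Fin n → Fin L) → ℝ) :
    ∑ φ, ∑ a, f (Function.update φ x a) = L * ∑ φ, f φ := by
  let e : ((Fin n → Fin L) × Fin L) ≃ ((Fin n → Fin L) × Fin L) :=
    { toFun := fun q => (Function.update q.1 x q.2, q.1 x)
      invFun := fun q => (Function.update q.1 x q.2, q.1 x)
      left_inv := fun q => by simp
      right_inv := fun q => by simp }
  calc ∑ φ, ∑ a, f (Function.update φ x a)
      = ∑ q : (Fin n → Fin L) × Fin L, f (e q).1 := by rw [Fintype.sum_prod_type]; rfl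
    _ = ∑ q : (Fin n → Fin L) × Fin L, f q.1 := e.sum_comp (fun q => f q.1)
    _ = L * ∑ φ, f φ := by
      rw [Fintype.sum_prod_type]
      simp [Finset.mul_sum]

theorem pin_update {W : Finset (Fin n)} {ψ φ : Fin n → Fin L} {x : Fin n} (hx : x ∉ W)
    (a : Fin L) : pin W ψ (Function.update φ x a) = Function.update (pin W ψ φ) x a := by
  ext v
  by_cases hv : v = x
  · subst hv; simp [pin, hx]
  · simp [pin, hv]

theorem pin_insert {W : Finset (Fin n)} {ψ φ : Fin n → Fin L} {x : Fin n} (hx : x ∉ W)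
    (a : Fin L) :
    pin (insert x W) (Function.update ψ x a) φ = pin W ψ (Function.update φ x a) := by
  ext v
  by_cases hv : v = x
  · subst hv; simp [pin, hx]
  · simp [pin, hv]

/-- A vertex outside `W` collides with another vertex with probability `1 / L`, independently of
everything that does not depend on its own value. -/
theorem sum_collide {W : Finset (Fin n)} (ψ : Fin n → Fin L) {x y : Fin n} (hx : x ∉ W)
    (hxy : y ≠ x) (g : (Fin n → Fin L) → ℝ) (hg : ∀ χ a, g (Function.update χ x a) = g χ) :
    L * ∑ φ, g (pin W ψ φ) * ind (pin W ψ φ x = pin W ψ φ y)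
      = ∑ φ, g (pin W ψ φ) := by
  rw [← sum_resample x]
  refine Finset.sum_congr rfl fun φ _ => ?_
  simp [pin_update hx, hg, Function.update_of_ne hxy, ← Finset.mul_sum, sum_ind_eq]

/-- The pairs that are queried on the graph `G`. -/
noncomputable def QueryTree.asked {α : Type} (G : SimpleGraph (Fin n)) :
    QueryTree n α → List (Fin n × Fin n)
  | .answer _ => []
  | .ask x y next =>
    haveI := Classical.propDecidable
    (x, y) :: (next (decide (G.Adj x y))).asked G

theorem QueryTree.length_asked {α : Type} (G : SimpleGraph (Fin n)) (t : QueryTree n α) :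
    (t.asked G).length = t.cost G := by
  induction t with
  | answer a => rfl
  | ask x y next ih => simp only [asked, cost, List.length_cons, ih]

theorem QueryTree.eval_congr {α : Type} {G H : SimpleGraph (Fin n)} (t : QueryTree n α)
    (h : ∀ e ∈ t.asked G, (G.Adj e.1 e.2 ↔ H.Adj e.1 e.2)) : t.eval H = t.eval G := by
  induction t with
  | answer a => rfl
  | ask x y next ih =>
    simp only [asked, List.mem_cons, forall_eq_or_imp] at h
    rw [eval, eval, ← ih _ h.2]
    congr 3
    exact propext h.1.symm

/-- The edges of `G` between vertices of `W` are those of the block graph of `ψ`. -/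
def AgreesOn (W : Finset (Fin n)) (ψ : Fin n → Fin L) (G : SimpleGraph (Fin n)) : Prop :=
  ∀ x ∈ W, ∀ y ∈ W, (G.Adj x y ↔ x ≠ y ∧ ψ x = ψ y)

theorem agreesOn_pin (W : Finset (Fin n)) (ψ φ : Fin n → Fin L) :
    AgreesOn W ψ (blockGraph (pin W ψ φ)) := by
  intro x hx y hy
  simp [blockGraph, pin, hx, hy]

theorem agreesOn_pinnedGraph (W : Finset (Fin n)) (ψ : Fin n → Fin L) :
    AgreesOn W ψ (pinnedGraph W ψ) := by
  intro x hx y hy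
  simp [pinnedGraph, hx, hy]

theorem AgreesOn.mono {W W' : Finset (Fin n)} {ψ ψ' : Fin n → Fin L} {G : SimpleGraph (Fin n)}
    (h : AgreesOn W' ψ' G) (hW : W ⊆ W') (hψ : ∀ v ∈ W, ψ' v = ψ v) : AgreesOn W ψ G := by
  intro x hx y hy
  rw [h x (hW hx) y (hW hy), hψ x hx, hψ y hy]

theorem exists_pin_insert (S : (Fin n → Fin L) → ℝ) (b : ℝ) {W : Finset (Fin n)}
    {ψ : Fin n → Fin L} (hb : b ≤ ∑ φ, S (pin W ψ φ)) (x : Fin n) :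
    ∃ ψ' : Fin n → Fin L, b ≤ ∑ φ, S (pin (insert x W) ψ' φ) ∧ ∀ v ∈ W, ψ' v = ψ v := by
  by_cases hx : x ∈ W
  · rw [Finset.insert_eq_of_mem hx]
    exact ⟨ψ, hb, fun _ _ => rfl⟩
  · by_contra! hcon
    have h : ∀ a, ∑ φ, S (pin (insert x W) (Function.update ψ x a) φ) < b := by
      intro a
      by_contra! h
      obtain ⟨v, hv, hne⟩ := hcon _ h
      refine hne (Function.update_of_ne ?_ _ _)
      rintro rfl
      exact hx hv
    have h2 : ∑ a : Fin L, ∑ φ, S (pin (insert x W) (Function.update ψ x a) φ)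
        < ∑ a : Fin L, b :=
      Finset.sum_lt_sum_of_nonempty ⟨ψ x, Finset.mem_univ _⟩ fun a _ => h a
    simp only [pin_insert hx] at h2
    rw [Finset.sum_comm, sum_resample x (fun φ => S (pin W ψ φ))] at h2
    simp only [Finset.sum_const, Finset.card_univ, Fintype.card_fin, nsmul_eq_mul] at h2
    exact absurd (mul_le_mul_of_nonneg_left hb (Nat.cast_nonneg L)) h2.not_ge

/-- The values of a random map can be fixed at the endpoints of the queries of an adaptive
algorithm, one endpoint after the other, such that the result of the algorithm becomes constant
and the probability of a given event does not drop. -/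
theorem QueryTree.exists_pin {α : Type} (t : QueryTree n α) (S : (Fin n → Fin L) → ℝ) (b : ℝ)
    (d : ℕ) (W : Finset (Fin n)) (ψ : Fin n → Fin L)
    (hcost : ∀ G, AgreesOn W ψ G → t.cost G ≤ d) (hb : b ≤ ∑ φ, S (pin W ψ φ)) :
    ∃ (W' : Finset (Fin n)) (ψ' : Fin n → Fin L) (a : α), W'.card ≤ W.card + 2 * d ∧
      b ≤ ∑ φ, S (pin W' ψ' φ) ∧ W ⊆ W' ∧ (∀ v ∈ W, ψ' v = ψ v) ∧
      ∀ G, AgreesOn W' ψ' G → t.eval G = a := by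
  induction t generalizing d W ψ with
  | answer a => exact ⟨W, ψ, a, by omega, hb, subset_rfl, fun _ _ => rfl, fun _ _ => rfl⟩
  | ask x y next ih =>
    obtain ⟨ψ₁, hb₁, h₁⟩ := exists_pin_insert S b hb x
    obtain ⟨ψ₂, hb₂, h₂⟩ := exists_pin_insert S b hb₁ y
    set W₂ := insert y (insert x W) with hW₂
    have hcard : W₂.card ≤ W.card + 2 :=
      (Finset.card_insert_le _ _).trans (by have := Finset.card_insert_le x W; omega)
    have hsub : W ⊆ W₂ := (Finset.subset_insert _ _).trans (Finset.subset_insert _ _)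
    have hψ : ∀ v ∈ W, ψ₂ v = ψ v := fun v hv =>
      (h₂ v (Finset.mem_insert_of_mem hv)).trans (h₁ v hv)
    classical
    -- after pinning both endpoints the answer to the first query is known
    have hans : ∀ G, AgreesOn W₂ ψ₂ G →
        next (@decide (G.Adj x y) (Classical.propDecidable _))
          = next (decide (x ≠ y ∧ ψ₂ x = ψ₂ y)) := by
      intro G hG
      congr 1
      have := hG x (by simp [hW₂]) y (by simp [hW₂])
      simp only [this]
    have hcost₂ : ∀ G, AgreesOn W₂ ψ₂ G →
        (next (decide (x ≠ y ∧ ψ₂ x = ψ₂ y))).cost G + 1 ≤ d := by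
      intro G hG
      have := hcost G (hG.mono hsub hψ)
      rwa [cost, hans G hG] at this
    obtain ⟨W', ψ', a, hc, hb', hs, he, ha⟩ := ih (decide (x ≠ y ∧ ψ₂ x = ψ₂ y)) (d - 1) W₂ ψ₂
      (fun G hG => by have := hcost₂ G hG; omega) hb₂
    refine ⟨W', ψ', a, ?_, hb', hsub.trans hs, fun v hv => ?_, fun G hG => ?_⟩
    · have := hcost₂ _ (agreesOn_pinnedGraph W₂ ψ₂)
      omega
    · rw [he v (hsub hv), hψ v hv]
    · rw [eval, hans G (hG.mono hs he), ha G hG]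

/-! ### Vertices whose queries miss all edges that are not pinned -/

/-- Some query of the tree `t` is answered on the block graph of `χ` in another way than on the
pinned graph. -/
def Informed {α : Type} (t : QueryTree n α) (W : Finset (Fin n)) (ψ χ : Fin n → Fin L) : Prop :=
  ∃ e ∈ t.asked (pinnedGraph W ψ),
    ¬ ((pinnedGraph W ψ).Adj e.1 e.2 ↔ (blockGraph χ).Adj e.1 e.2)

theorem sum_differ_le (W : Finset (Fin n)) (ψ : Fin n → Fin L) (x y : Fin n) :
    L * ∑ φ, ind (¬ ((pinnedGraph W ψ).Adj x y ↔ (blockGraph (pin W ψ φ)).Adj x y))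
      ≤ (L : ℝ) ^ n := by
  have hcol : ∀ x y : Fin n, x ∉ W → y ≠ x →
      L * ∑ φ, ind (pin W ψ φ x = pin W ψ φ y) = (L : ℝ) ^ n := by
    intro x y hx hxy
    have := sum_collide ψ hx hxy (fun _ => 1) (fun _ _ => rfl)
    simpa using this
  by_cases hxy : y = x
  · simp [hxy, ind]
  by_cases hx : x ∈ W
  · by_cases hy : y ∈ W
    · simp [pinnedGraph, blockGraph, pin, hx, hy, ind]
    · rw [← hcol y x hy (Ne.symm hxy)]
      gcongr with φ
      refine ind_mono fun h => ?_
      simp only [pinnedGraph, blockGraph, hy] at h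
      tauto
  · rw [← hcol x y hx hxy]
    gcongr with φ
    refine ind_mono fun h => ?_
    simp only [pinnedGraph, blockGraph, hx] at h
    tauto

/-- Each of the at most `q` queries that are made on the pinned graph has another answer on the
random block graph with probability at most `1 / L`. -/
theorem sum_informed_le {α : Type} {t : QueryTree n α} {q : ℕ} (W : Finset (Fin n))
    (ψ : Fin n → Fin L) (hq : t.cost (pinnedGraph W ψ) ≤ q) :
    L * ∑ φ, ind (Informed t W ψ (pin W ψ φ)) ≤ q * (L : ℝ) ^ n := by
  have key : ∀ l : List (Fin n × Fin n), L * ∑ φ, ind (∃ e ∈ l,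
      ¬ ((pinnedGraph W ψ).Adj e.1 e.2 ↔ (blockGraph (pin W ψ φ)).Adj e.1 e.2))
      ≤ l.length * (L : ℝ) ^ n := by
    intro l
    induction l with
    | nil => simp [ind]
    | cons e l ih =>
      have h := sum_differ_le W ψ e.1 e.2
      have h2 : ∀ φ, ind (∃ e' ∈ e :: l, ¬ ((pinnedGraph W ψ).Adj e'.1 e'.2 ↔
            (blockGraph (pin W ψ φ)).Adj e'.1 e'.2))
          ≤ ind (¬ ((pinnedGraph W ψ).Adj e.1 e.2 ↔ (blockGraph (pin W ψ φ)).Adj e.1 e.2))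
            + ind (∃ e' ∈ l, ¬ ((pinnedGraph W ψ).Adj e'.1 e'.2 ↔
              (blockGraph (pin W ψ φ)).Adj e'.1 e'.2)) := by
        intro φ
        simp only [List.mem_cons, exists_eq_or_imp]
        exact ind_or_le _ _
      have h3 := mul_le_mul_of_nonneg_left (Finset.sum_le_sum fun φ (_ : φ ∈ Finset.univ) => h2 φ)
        (Nat.cast_nonneg (α := ℝ) L)
      rw [Finset.sum_add_distrib, mul_add] at h3
      push_cast [List.length_cons]
      linarith
  refine (key (t.asked (pinnedGraph W ψ))).trans ?_
  rw [t.length_asked]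
  gcongr

/-- The expected number of vertices in the same block as an informed vertex `v`: up to vertices
that are pinned or mentioned in a query, collisions with `v` are independent of `v` being
informed. -/
theorem sum_informed_collide_le {α : Type} {t : QueryTree n α} {q : ℕ} (W : Finset (Fin n))
    (ψ : Fin n → Fin L) (hq : t.cost (pinnedGraph W ψ) ≤ q) (v : Fin n) :
    (L : ℝ) ^ 2 * ∑ φ, ∑ w, ind (Informed t W ψ (pin W ψ φ) ∧ pin W ψ φ v = pin W ψ φ w)
      ≤ (n * q + L ^ 2 * (W.card + 2 * q + 1)) * (L : ℝ) ^ n := by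
  classical
  set l := t.asked (pinnedGraph W ψ) with hl
  set B : Finset (Fin n) := insert v (W ∪ ((l.map Prod.fst).toFinset ∪ (l.map Prod.snd).toFinset))
    with hB
  have hBc : (B.card : ℝ) ≤ W.card + 2 * q + 1 := by
    have h1 : (l.map Prod.fst).toFinset.card ≤ q :=
      (List.toFinset_card_le _).trans (by rw [List.length_map, hl, t.length_asked]; exact hq)
    have h2 : (l.map Prod.snd).toFinset.card ≤ q :=
      (List.toFinset_card_le _).trans (by rw [List.length_map, hl, t.length_asked]; exact hq)
    have h3 := Finset.card_union_le (l.map Prod.fst).toFinset (l.map Prod.snd).toFinset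
    have h4 := Finset.card_union_le W ((l.map Prod.fst).toFinset ∪ (l.map Prod.snd).toFinset)
    have h5 := Finset.card_insert_le v
      (W ∪ ((l.map Prod.fst).toFinset ∪ (l.map Prod.snd).toFinset))
    have : B.card ≤ W.card + 2 * q + 1 := by rw [hB]; omega
    exact_mod_cast this
  have hw : ∀ w, (L : ℝ) ^ 2 * ∑ φ, ind (Informed t W ψ (pin W ψ φ) ∧
      pin W ψ φ v = pin W ψ φ w) ≤ q * (L : ℝ) ^ n + ind (w ∈ B) * (L ^ 2 * (L : ℝ) ^ n) := by
    intro w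
    by_cases hwB : w ∈ B
    · have : ∑ φ, ind (Informed t W ψ (pin W ψ φ) ∧ pin W ψ φ v = pin W ψ φ w)
          ≤ ∑ φ : Fin n → Fin L, (1 : ℝ) := Finset.sum_le_sum fun φ _ => ind_le_one _
      have h2 : ∑ φ : Fin n → Fin L, (1 : ℝ) = (L : ℝ) ^ n := by simp
      rw [h2] at this
      rw [ind_true hwB, one_mul]
      have h4 := mul_le_mul_of_nonneg_left this (sq_nonneg (L : ℝ))
      have : (0 : ℝ) ≤ q * (L : ℝ) ^ n := by positivity
      linarith
    · rw [ind_false hwB, zero_mul, add_zero]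
      simp only [hB, Finset.mem_insert, Finset.mem_union, List.mem_toFinset, List.mem_map,
        not_or, not_exists, not_and] at hwB
      obtain ⟨hwv, hwW, hw1, hw2⟩ := hwB
      have hg : ∀ (χ : Fin n → Fin L) (a : Fin L),
          ind (Informed t W ψ (Function.update χ w a)) = ind (Informed t W ψ χ) := by
        intro χ a
        congr 1
        refine propext (exists_congr fun e => and_congr_right fun he => ?_)
        have e1 : e.1 ≠ w := fun h => hw1 e he h
        have e2 : e.2 ≠ w := fun h => hw2 e he h
        simp [blockGraph, Function.update_of_ne e1, Function.update_of_ne e2]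
      have h4 := sum_collide ψ hwW (Ne.symm hwv) (fun χ => ind (Informed t W ψ χ)) hg
      have h5 : ∀ φ, ind (Informed t W ψ (pin W ψ φ) ∧ pin W ψ φ v = pin W ψ φ w)
          = ind (Informed t W ψ (pin W ψ φ)) * ind (pin W ψ φ w = pin W ψ φ v) := by
        intro φ
        rw [ind_and, eq_comm (a := pin W ψ φ v)]
      simp_rw [h5]
      rw [pow_two, mul_assoc, h4]
      exact sum_informed_le W ψ hq
  rw [Finset.sum_comm, Finset.mul_sum]
  refine (Finset.sum_le_sum fun w _ => hw w).trans ?_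
  rw [Finset.sum_add_distrib, ← Finset.sum_mul _ _ (_ * _), sum_ind_mem]
  simp only [Finset.sum_const, Finset.card_univ, Fintype.card_fin, nsmul_eq_mul]
  have h7 : (B.card : ℝ) * (L ^ 2 * (L : ℝ) ^ n)
      ≤ (W.card + 2 * q + 1) * (L ^ 2 * (L : ℝ) ^ n) := by gcongr
  linarith

/-! ### The lower bound on the number of queries -/

theorem sq_le_mul_sum_same_block (χ : Fin n → Fin L) :
    (n : ℝ) ^ 2 ≤ L * ∑ v, ∑ w, ind (χ v = χ w) := by
  have h := sq_sum_le_card_mul_sum_sq (s := (Finset.univ : Finset (Fin L)))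
    (f := fun i => ∑ v, ind (i = χ v))
  rw [Finset.sum_comm] at h
  simp only [sum_ind_eq, Finset.sum_const, Finset.card_univ, Fintype.card_fin, nsmul_eq_mul,
    mul_one] at h
  refine h.trans (le_of_eq ?_)
  congr 1
  simp_rw [pow_two, Finset.sum_mul_sum]
  rw [Finset.sum_comm]
  refine Finset.sum_congr rfl fun v _ => ?_
  rw [Finset.sum_comm]
  refine Finset.sum_congr rfl fun w _ => ?_
  have h1 : ∀ i, ind (i = χ v) * ind (i = χ w) = ind (χ v = χ w) * ind (i = χ v) := by
    intro i
    rw [← ind_and, ← ind_and]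
    exact ind_congr ⟨fun h => ⟨h.1.symm.trans h.2, h.1⟩, fun h => ⟨h.2, h.2.trans h.1⟩⟩
  simp_rw [h1, ← Finset.mul_sum, sum_ind_eq, mul_one]

theorem sum_same_block_le {χ : Fin n → Fin L} {cl cl₀ : Fin n → ℕ} {I : Fin n → Prop}
    (h : ∀ v, ¬ I v → cl v = cl₀ v) :
    ∑ v, ∑ w, ind (χ v = χ w) ≤ 2 * (disagreements (blockGraph χ) cl : ℝ)
      + ∑ v, ∑ w, ind (cl₀ v = cl₀ w ∧ χ v = χ w) + 2 * ∑ v, ∑ w, ind (I v ∧ χ v = χ w) := by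
  rw [two_mul_disagreements, two_mul (∑ v, ∑ w, ind (I v ∧ χ v = χ w))]
  nth_rw 4 [Finset.sum_comm]
  simp only [← Finset.sum_add_distrib]
  refine Finset.sum_le_sum fun v _ => Finset.sum_le_sum fun w _ => ?_
  have h1 : ind (χ v = χ w) ≤ ind ((Errs (blockGraph χ) cl v w ∨ (cl₀ v = cl₀ w ∧ χ v = χ w)) ∨
      ((I v ∧ χ v = χ w) ∨ (I w ∧ χ w = χ v))) := by
    refine ind_mono fun e => ?_
    by_contra hc
    simp only [Errs, near_blockGraph] at hc
    have := h v
    have := h w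
    grind
  have h2 := ind_or_le (Errs (blockGraph χ) cl v w ∨ (cl₀ v = cl₀ w ∧ χ v = χ w))
    ((I v ∧ χ v = χ w) ∨ (I w ∧ χ w = χ v))
  have h3 := ind_or_le (Errs (blockGraph χ) cl v w) (cl₀ v = cl₀ w ∧ χ v = χ w)
  have h4 := ind_or_le (I v ∧ χ v = χ w) (I w ∧ χ w = χ v)
  linarith

theorem sum_same_label_le {χ : Fin n → Fin L} {cl cl₀ : Fin n → ℕ} {I : Fin n → Prop}
    (h : ∀ v, ¬ I v → cl v = cl₀ v) :
    ∑ v, ∑ w, ind (cl₀ v = cl₀ w) ≤ 2 * (disagreements (blockGraph χ) cl : ℝ)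
      + ∑ v, ∑ w, ind (cl₀ v = cl₀ w ∧ χ v = χ w) + 2 * (n * ∑ v, ind (I v)) := by
  have e1 : n * ∑ v, ind (I v) = ∑ v, ∑ _w : Fin n, ind (I v) := by
    simp [Finset.mul_sum]
  have e2 : n * ∑ v, ind (I v) = ∑ _v : Fin n, ∑ w, ind (I w) := by simp
  rw [two_mul_disagreements, two_mul (n * ∑ v, ind (I v))]
  nth_rw 1 [e1]
  rw [e2]
  simp only [← Finset.sum_add_distrib]
  refine Finset.sum_le_sum fun v _ => Finset.sum_le_sum fun w _ => ?_
  have h1 : ind (cl₀ v = cl₀ w) ≤ ind ((Errs (blockGraph χ) cl v w ∨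
      (cl₀ v = cl₀ w ∧ χ v = χ w)) ∨ (I v ∨ I w)) := by
    refine ind_mono fun e => ?_
    by_contra hc
    simp only [Errs, near_blockGraph] at hc
    have := h v
    have := h w
    grind
  have h2 := ind_or_le (Errs (blockGraph χ) cl v w ∨ (cl₀ v = cl₀ w ∧ χ v = χ w)) (I v ∨ I w)
  have h3 := ind_or_le (Errs (blockGraph χ) cl v w) (cl₀ v = cl₀ w ∧ χ v = χ w)
  have h4 := ind_or_le (I v) (I w)
  linarith

/-- A fixed labelling has few pairs of equal labels inside the blocks of a random map. -/
theorem sum_same_label_collide_le (W : Finset (Fin n)) (ψ : Fin n → Fin L) (cl₀ : Fin n → ℕ) :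
    L * ∑ φ, ∑ v, ∑ w, ind (cl₀ v = cl₀ w ∧ pin W ψ φ v = pin W ψ φ w)
      ≤ (∑ v, ∑ w, ind (cl₀ v = cl₀ w) + L * (n * (W.card + 1))) * (L : ℝ) ^ n := by
  have h : ∀ v w, L * ∑ φ, ind (cl₀ v = cl₀ w ∧ pin W ψ φ v = pin W ψ φ w)
      ≤ (ind (cl₀ v = cl₀ w) + L * (ind (w = v) + ind (v ∈ W))) * (L : ℝ) ^ n := by
    intro v w
    by_cases hvw : v ∈ W ∨ w = v
    · have h1 : ∑ φ, ind (cl₀ v = cl₀ w ∧ pin W ψ φ v = pin W ψ φ w) ≤ (L : ℝ) ^ n := by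
        refine (Finset.sum_le_sum fun φ _ => ind_le_one _).trans (le_of_eq ?_)
        simp
      have h2 : 1 ≤ ind (w = v) + ind (v ∈ W) := by
        rcases hvw with hv | hv
        · rw [ind_true hv]; linarith [ind_nonneg (w = v)]
        · rw [ind_true hv]; linarith [ind_nonneg (v ∈ W)]
      have h3 : (L : ℝ) * ∑ φ, ind (cl₀ v = cl₀ w ∧ pin W ψ φ v = pin W ψ φ w)
          ≤ L * (1 * (L : ℝ) ^ n) := by rw [one_mul]; gcongr
      have h4 : (L : ℝ) * (1 * (L : ℝ) ^ n)
          ≤ L * ((ind (w = v) + ind (v ∈ W)) * (L : ℝ) ^ n) := by gcongr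
      have h5 : 0 ≤ ind (cl₀ v = cl₀ w) * (L : ℝ) ^ n :=
        mul_nonneg (ind_nonneg _) (by positivity)
      linarith
    · rw [not_or] at hvw
      rw [ind_false hvw.1, ind_false hvw.2]
      have := sum_collide ψ hvw.1 hvw.2 (fun _ => ind (cl₀ v = cl₀ w)) (fun _ _ => rfl)
      simp_rw [ind_and, this]
      simp [mul_comm]
  have e : ∑ φ, ∑ v, ∑ w, ind (cl₀ v = cl₀ w ∧ pin W ψ φ v = pin W ψ φ w)
      = ∑ v, ∑ w, ∑ φ, ind (cl₀ v = cl₀ w ∧ pin W ψ φ v = pin W ψ φ w) := by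
    rw [Finset.sum_comm]
    exact Finset.sum_congr rfl fun v _ => Finset.sum_comm
  rw [e]
  simp_rw [Finset.mul_sum (a := (L : ℝ))] at h ⊢
  refine (Finset.sum_le_sum fun v _ => Finset.sum_le_sum fun w _ => h v w).trans (le_of_eq ?_)
  simp_rw [← Finset.sum_mul, Finset.sum_add_distrib, ← Finset.mul_sum, Finset.sum_add_distrib,
    sum_ind_eq]
  simp only [Finset.sum_const, Finset.card_univ, Fintype.card_fin, nsmul_eq_mul,
    ← Finset.mul_sum, sum_ind_mem]
  ring

/-- The arithmetic behind `few_queries_fail`. -/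
theorem few_queries_arith {δ L n w q M Z a₀ a₁ i P : ℝ} (hδ : 0 < δ) (hδ1 : δ ≤ 1) (hL0 : 0 < L)
    (hn0 : 0 < n) (hw : 0 ≤ w) (hq0 : 0 ≤ q) (hM0 : 0 < M) (hL : 16 ≤ δ * L)
    (hqL : 64 * q ≤ δ ^ 2 * L) (hnL : 32 * (L * (3 * w + 4 * q + 3)) ≤ δ ^ 2 * n)
    (EA₀ : L * a₀ ≤ (Z + L * (n * (w + 1))) * M)
    (EA₁ : L ^ 2 * a₁ ≤ n * ((n * q + L ^ 2 * (w + 2 * q + 1)) * M)) (EI : L * i ≤ n * (q * M))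
    (s1 : P * (n ^ 2 / (2 * L)) ≤ a₀ + 2 * a₁)
    (s2 : P * (Z - n ^ 2 / (2 * L)) ≤ a₀ + 2 * (n * i)) (hsucc : δ * M ≤ P) : False := by
  have hδL : 1 / L ≤ δ / 16 := by rw [div_le_div_iff₀ hL0 (by norm_num)]; linarith
  have hqL' : q / L ≤ δ ^ 2 / 64 := by rw [div_le_div_iff₀ hL0 (by norm_num)]; linarith
  have hδ2 : δ ^ 2 ≤ δ := by rw [pow_two]; exact mul_le_of_le_one_left hδ.le hδ1
  have hwL : n * (L * (3 * w + 4 * q + 3)) ≤ δ ^ 2 / 32 * n ^ 2 := by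
    have := mul_le_mul_of_nonneg_left hnL hn0.le
    linarith
  -- many pairs agree
  have hZ1 : δ / 4 * n ^ 2 ≤ Z := by
    have e1 : δ * M * (n ^ 2 / (2 * L)) ≤ a₀ + 2 * a₁ :=
      (mul_le_mul_of_nonneg_right hsucc (by positivity)).trans s1
    have e2 : M * (δ * n ^ 2 / 2) ≤ M * (Z + L * (n * (w + 1)) + 2 * (n ^ 2 * (q / L)
        + n * L * (w + 2 * q + 1))) := by
      have f1 : L * (δ * M * (n ^ 2 / (2 * L))) = M * (δ * n ^ 2 / 2) := by field_simp
      have f2 : L * a₁ ≤ M * (n ^ 2 * (q / L) + n * L * (w + 2 * q + 1)) := by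
        have : M * (n ^ 2 * (q / L) + n * L * (w + 2 * q + 1))
            = n * ((n * q + L ^ 2 * (w + 2 * q + 1)) * M) / L := by field_simp
        rw [this, le_div_iff₀ hL0]
        linarith
      have f3 := mul_le_mul_of_nonneg_left e1 hL0.le
      linarith
    have e3 := le_of_mul_le_mul_left e2 hM0
    have e4 : n ^ 2 * (q / L) ≤ n ^ 2 * (δ / 64) :=
      mul_le_mul_of_nonneg_left (by linarith) (by positivity)
    have e5 : δ ^ 2 / 32 * n ^ 2 ≤ δ / 32 * n ^ 2 := by gcongr
    have e6 : 0 < δ * n ^ 2 := by positivity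
    linarith
  have hn2L : n ^ 2 / (2 * L) ≤ δ / 32 * n ^ 2 := by
    have : n ^ 2 / (2 * L) = 1 / L * (n ^ 2 / 2) := by field_simp
    rw [this]
    have := mul_le_mul_of_nonneg_right hδL (by positivity : 0 ≤ n ^ 2 / 2)
    linarith
  -- but not that many
  have e1 : δ * M * (Z - n ^ 2 / (2 * L)) ≤ a₀ + 2 * (n * i) := by
    refine (mul_le_mul_of_nonneg_right hsucc ?_).trans s2
    have : 0 < δ * n ^ 2 := by positivity
    linarith
  have e2 : M * (δ * (Z - n ^ 2 / (2 * L)))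
      ≤ M * (1 / L * Z + n * (w + 1) + 2 * (n ^ 2 * (q / L))) := by
    have f1 : a₀ ≤ M * (1 / L * Z + n * (w + 1)) := by
      have : M * (1 / L * Z + n * (w + 1)) = (Z + L * (n * (w + 1))) * M / L := by field_simp
      rw [this, le_div_iff₀ hL0]
      linarith
    have f2 : n * i ≤ M * (n ^ 2 * (q / L)) := by
      have : M * (n ^ 2 * (q / L)) = n * (n * (q * M)) / L := by field_simp
      rw [this, le_div_iff₀ hL0]
      have := mul_le_mul_of_nonneg_left EI hn0.le
      linarith
    linarith
  have e3 := le_of_mul_le_mul_left e2 hM0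
  have hZ0 : 0 ≤ Z := le_trans (by positivity) hZ1
  have e4 := mul_le_mul_of_nonneg_right hδL hZ0
  have e5 := mul_le_mul_of_nonneg_left hqL' (by positivity : 0 ≤ n ^ 2)
  have hL1 : 1 ≤ L := by
    have := mul_le_of_le_one_left hL0.le hδ1
    linarith
  have e6 : n * (w + 1) ≤ δ ^ 2 / 32 * n ^ 2 := by
    refine le_trans ?_ hwL
    refine mul_le_mul_of_nonneg_left ?_ hn0.le
    exact le_trans (by linarith) (le_mul_of_one_le_left (by positivity) hL1)
  have e7 := mul_le_mul_of_nonneg_left hn2L hδ.le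
  have e8 := mul_le_mul_of_nonneg_left hZ1 hδ.le
  have e9 : 0 < δ ^ 2 * n ^ 2 := by positivity
  linarith

/-- Once the preprocessing is over, few queries per vertex do not suffice.  Most vertices get the
label that they have on the pinned graph.  These labels do not depend on the random blocks: if few
pairs of them agree, too many pairs inside blocks are separated, and if many of them agree, too
many pairs across blocks are joined. -/
theorem few_queries_fail {W : Finset (Fin n)} {ψ : Fin n → Fin L} {t : Fin n → QueryTree n ℕ}
    {q : ℕ} {δ : ℝ} (hδ : 0 < δ) (hδ1 : δ ≤ 1) (hn : 0 < n)
    (hq : ∀ v, (t v).cost (pinnedGraph W ψ) ≤ q) (hL : 16 ≤ δ * L) (hqL : 64 * q ≤ δ ^ 2 * L)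
    (hnL : 32 * (L * (3 * W.card + 4 * q + 3)) ≤ δ ^ 2 * n) :
    ∑ φ, ind (2 * (disagreements (blockGraph (pin W ψ φ))
        (fun v => (t v).eval (blockGraph (pin W ψ φ))) : ℝ) ≤ n ^ 2 / (2 * L))
      < δ * (L : ℝ) ^ n := by
  by_contra! hsucc
  have hL0 : (0 : ℝ) < L := by
    by_contra! h
    nlinarith
  have hn0 : (0 : ℝ) < n := by exact_mod_cast hn
  set cl₀ : Fin n → ℕ := fun v => (t v).eval (pinnedGraph W ψ) with hcl₀
  have hinf : ∀ φ v, ¬ Informed (t v) W ψ (pin W ψ φ) →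
      (t v).eval (blockGraph (pin W ψ φ)) = cl₀ v := by
    intro φ v h
    refine (t v).eval_congr fun e he => ?_
    by_contra hc
    exact h ⟨e, he, hc⟩
  set M : ℝ := (L : ℝ) ^ n with hM
  have hM0 : 0 < M := by positivity
  set Z : ℝ := ∑ v, ∑ w, ind (cl₀ v = cl₀ w) with hZ
  set A₀ : (Fin n → Fin L) → ℝ := fun φ =>
    ∑ v, ∑ w, ind (cl₀ v = cl₀ w ∧ pin W ψ φ v = pin W ψ φ w) with hA₀
  set A₁ : (Fin n → Fin L) → ℝ := fun φ =>
    ∑ v, ∑ w, ind (Informed (t v) W ψ (pin W ψ φ) ∧ pin W ψ φ v = pin W ψ φ w) with hA₁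
  set I : (Fin n → Fin L) → ℝ := fun φ => ∑ v, ind (Informed (t v) W ψ (pin W ψ φ)) with hI
  set D : (Fin n → Fin L) → ℝ := fun φ => 2 * (disagreements (blockGraph (pin W ψ φ))
        (fun v => (t v).eval (blockGraph (pin W ψ φ))) : ℝ) with hD
  have hA₀n : ∀ φ, 0 ≤ A₀ φ := fun φ =>
    Finset.sum_nonneg fun v _ => Finset.sum_nonneg fun w _ => ind_nonneg _
  have hA₁n : ∀ φ, 0 ≤ A₁ φ := fun φ =>
    Finset.sum_nonneg fun v _ => Finset.sum_nonneg fun w _ => ind_nonneg _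
  have hIn : ∀ φ, 0 ≤ I φ := fun φ => Finset.sum_nonneg fun v _ => ind_nonneg _
  -- the expectations of `A₀`, `A₁` and `I`
  have EA₀ : L * ∑ φ, A₀ φ ≤ (Z + L * (n * (W.card + 1))) * M := sum_same_label_collide_le W ψ cl₀
  have EA₁ : (L : ℝ) ^ 2 * ∑ φ, A₁ φ ≤ n * ((n * q + L ^ 2 * (W.card + 2 * q + 1)) * M) := by
    rw [hA₁, Finset.sum_comm, Finset.mul_sum]
    refine (Finset.sum_le_sum fun v _ => sum_informed_collide_le W ψ (hq v) v).trans ?_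
    simp [hM]
  have EI : L * ∑ φ, I φ ≤ n * (q * M) := by
    rw [hI, Finset.sum_comm, Finset.mul_sum]
    refine (Finset.sum_le_sum fun v _ => sum_informed_le W ψ (hq v)).trans ?_
    simp [hM]
  -- the two lower bounds on them that hold whenever the algorithm succeeds
  have h1 : ∀ φ, ind (D φ ≤ n ^ 2 / (2 * L)) * (n ^ 2 / (2 * L)) ≤ A₀ φ + 2 * A₁ φ := by
    intro φ
    by_cases hs : D φ ≤ n ^ 2 / (2 * L)
    · rw [ind_true hs, one_mul]
      have e1 := sq_le_mul_sum_same_block (pin W ψ φ)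
      have e2 := sum_same_block_le (χ := pin W ψ φ) (hinf φ)
      have e3 : (n : ℝ) ^ 2 / L ≤ ∑ v, ∑ w, ind (pin W ψ φ v = pin W ψ φ w) := by
        rw [div_le_iff₀ hL0]; linarith
      have e4 : (n : ℝ) ^ 2 / L = n ^ 2 / (2 * L) + n ^ 2 / (2 * L) := by field_simp; ring
      change _ ≤ D φ + A₀ φ + 2 * A₁ φ at e2
      linarith
    · rw [ind_false hs]
      linarith [hA₀n φ, hA₁n φ]
  have h2 : ∀ φ, ind (D φ ≤ n ^ 2 / (2 * L)) * (Z - n ^ 2 / (2 * L))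
      ≤ A₀ φ + 2 * (n * I φ) := by
    intro φ
    by_cases hs : D φ ≤ n ^ 2 / (2 * L)
    · rw [ind_true hs, one_mul]
      have e2 := sum_same_label_le (χ := pin W ψ φ) (hinf φ)
      change Z ≤ D φ + A₀ φ + 2 * (n * I φ) at e2
      linarith
    · rw [ind_false hs]
      have := mul_nonneg hn0.le (hIn φ)
      linarith [hA₀n φ]
  have s1 := Finset.sum_le_sum fun φ (_ : φ ∈ Finset.univ) => h1 φ
  have s2 := Finset.sum_le_sum fun φ (_ : φ ∈ Finset.univ) => h2 φ
  rw [← Finset.sum_mul, Finset.sum_add_distrib, ← Finset.mul_sum] at s1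
  rw [← Finset.sum_mul, Finset.sum_add_distrib, ← Finset.mul_sum, ← Finset.mul_sum] at s2
  set P := ∑ φ, ind (D φ ≤ n ^ 2 / (2 * L)) with hP
  exact few_queries_arith hδ hδ1 hL0 hn0 (Nat.cast_nonneg _) (Nat.cast_nonneg _) hM0 hL hqL hnL
    EA₀ EA₁ EI s1 s2 hsucc

theorem exists_seed {Ω : Type} [MeasurableSpace Ω] (μ : Measure Ω) [IsProbabilityMeasure μ]
    {ι : Type*} [Fintype ι] (S : ι → Set Ω) (hS : ∀ i, MeasurableSet (S i)) {δ : ℝ}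
    (h : ∀ i, δ ≤ μ.real (S i)) : ∃ ω, δ * Fintype.card ι ≤ ∑ i, ind (ω ∈ S i) := by
  classical
  have hi : ∀ i, (fun ω => ind (ω ∈ S i)) = (S i).indicator 1 := by
    intro i
    ext ω
    by_cases hω : ω ∈ S i <;> simp [ind, hω]
  have hint : ∀ i, Integrable (fun ω => ind (ω ∈ S i)) μ := by
    intro i
    rw [hi]
    exact (integrable_const (1 : ℝ)).indicator (hS i)
  obtain ⟨ω, hω⟩ := exists_integral_le (integrable_finsetSum Finset.univ fun i _ => hint i)
  refine ⟨ω, le_trans ?_ hω⟩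
  rw [integral_finsetSum _ fun i _ => hint i]
  simp only [hi, integral_indicator_one (hS _)]
  calc δ * Fintype.card ι = ∑ _i : ι, δ := by simp [mul_comm]
    _ ≤ _ := Finset.sum_le_sum fun i _ => h i

theorem query_lower_bound (c δ : ℝ) (hδ : 0 < δ) : ∃ K ε₀ : ℝ, 0 < K ∧ 0 < ε₀ ∧
      ∀ ε : ℝ, 0 < ε → ε < ε₀ → ∀ p : ℕ, ∃ N : ℕ, ∀ n : ℕ, N ≤ n →
        ∀ (Ω : Type) [MeasurableSpace Ω] (μ : Measure Ω) [IsProbabilityMeasure μ]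
          (A : LocalQueryAlgorithm n Ω) (q : ℕ),
          A.HasQueryComplexity p q →
          (∀ (G : SimpleGraph (Fin n)) (v : Fin n), Measurable fun ω => A.label G ω v) →
          (∀ G : SimpleGraph (Fin n), δ ≤ μ.real {ω | IsApproxClustering c ε G (A.label G ω)}) →
          K / ε ≤ (q : ℝ) := by
  refine ⟨δ ^ 2 / 512, min (1 / 8) (δ / 128), by positivity, by positivity, ?_⟩
  intro ε hε hε0 p
  obtain ⟨hε1, hε2⟩ := lt_min_iff.1 hε0
  -- the number of blocks; a perfect clustering of the blocks is twice as good as required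
  set L := ⌊1 / (4 * ε)⌋₊ with hLdef
  have hLu : (L : ℝ) ≤ 1 / (4 * ε) := Nat.floor_le (by positivity)
  have hLl : 1 / (8 * ε) ≤ (L : ℝ) := by
    have h1 : 1 / (4 * ε) < L + 1 := Nat.lt_floor_add_one _
    have h2 : 1 / (4 * ε) = 1 / (8 * ε) + 1 / (8 * ε) := by field_simp; norm_num
    have h3 : 1 ≤ 1 / (8 * ε) := by rw [le_div_iff₀ (by positivity)]; linarith
    linarith
  set B : ℝ := 32 * (L * (6 * p + 4 * (δ ^ 2 / 512 / ε) + 3)) / δ ^ 2 with hB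
  refine ⟨⌈B⌉₊ + 1, ?_⟩
  intro n hn Ω _ μ _ A q hA hmeas hsucc
  by_contra! hq
  have hn0 : 0 < n := by omega
  have hnB : B ≤ n := (Nat.le_ceil B).trans (by exact_mod_cast (by omega : ⌈B⌉₊ ≤ n))
  have hδ1 : δ ≤ 1 := (hsucc ⊥).trans measureReal_le_one
  have hL0 : (0 : ℝ) < L := lt_of_lt_of_le (by positivity) hLl
  obtain ⟨ω, hω⟩ := exists_seed μ
    (fun φ : Fin n → Fin L =>
      {ω | IsApproxClustering c ε (blockGraph φ) (A.label (blockGraph φ) ω)})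
    (fun φ => (measurable_pi_lambda _ (hmeas (blockGraph φ)))
      (MeasurableSet.of_discrete (s := {cl | IsApproxClustering c ε (blockGraph φ) cl})))
    (fun φ => hsucc (blockGraph φ))
  let ψ₀ : Fin n → Fin L := fun _ => ⟨0, by exact_mod_cast hL0⟩
  have hpin : ∀ φ : Fin n → Fin L, pin ∅ ψ₀ φ = φ := fun φ => by ext v; simp [pin]
  obtain ⟨W, ψ, t, hW, hd, -, -, ht⟩ := (A ω).exists_pin
    (fun χ => ind (IsApproxClustering c ε (blockGraph χ) (A.label (blockGraph χ) ω)))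
    (δ * (L : ℝ) ^ n) p ∅ ψ₀ (fun G _ => (hA G ω).1) (by simpa [hpin] using hω)
  have hWp : (W.card : ℝ) ≤ 2 * p := by
    have : W.card ≤ 2 * p := by simpa using hW
    exact_mod_cast this
  refine absurd hd (not_le.2 (lt_of_le_of_lt ?_ (few_queries_fail (W := W) (ψ := ψ) (t := t)
    (q := q) hδ hδ1 hn0 ?_ ?_ ?_ ?_)))
  · refine Finset.sum_le_sum fun φ _ => ind_mono fun h => ?_
    have e : A.label (blockGraph (pin W ψ φ)) ω
        = fun v => (t v).eval (blockGraph (pin W ψ φ)) := by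
      funext v
      rw [LocalQueryAlgorithm.label, ht _ (agreesOn_pin W ψ φ)]
    rw [IsApproxClustering, optCost_blockGraph, e] at h
    have h1 : ε ≤ 1 / (4 * L) := by
      rw [le_div_iff₀ (by positivity)]
      rw [le_div_iff₀ (by positivity)] at hLu
      linarith
    have h2 : ε * (n : ℝ) ^ 2 ≤ 1 / (4 * L) * (n : ℝ) ^ 2 := by gcongr
    have h3 : (n : ℝ) ^ 2 / (2 * L) = 2 * (1 / (4 * L) * (n : ℝ) ^ 2) := by field_simp; norm_num
    rw [h3]
    simp only [Nat.cast_zero, mul_zero, zero_add] at h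
    linarith
  · intro v
    have := (hA (pinnedGraph W ψ) ω).2 v
    rwa [ht _ (agreesOn_pinnedGraph W ψ)] at this
  · have : 16 = δ * (1 / (8 * (δ / 128))) := by field_simp; norm_num
    rw [this]
    refine mul_le_mul_of_nonneg_left (le_trans ?_ hLl) hδ.le
    gcongr
  · have : 64 * (δ ^ 2 / 512 / ε) = δ ^ 2 * (1 / (8 * ε)) := by field_simp; norm_num
    nlinarith [sq_nonneg δ]
  · rw [hB, div_le_iff₀ (by positivity)] at hnB
    have : 32 * ((L : ℝ) * (3 * W.card + 4 * q + 3))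
        ≤ 32 * (L * (6 * p + 4 * (δ ^ 2 / 512 / ε) + 3)) := by
      refine mul_le_mul_of_nonneg_left (mul_le_mul_of_nonneg_left ?_ hL0.le) (by norm_num)
      linarith
    linarith

end LowerBound

/-! ### Finite stretches of the random tape -/

section Tape

variable {n : ℕ}

/-- The expectation of `f` on a list of `m` independent uniformly random vertices. -/
noncomputable def drawMean : ℕ → (List (Fin n) → ℝ) → ℝ
  | 0, f => f []
  | m + 1, f => (∑ u, drawMean m fun l => f (u :: l)) / n

theorem drawMean_mono {m : ℕ} {f g : List (Fin n) → ℝ} (h : ∀ l, l.length = m → f l ≤ g l) :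
    drawMean m f ≤ drawMean m g := by
  induction m generalizing f g with
  | zero => exact h [] rfl
  | succ m ih =>
    refine div_le_div_of_nonneg_right (Finset.sum_le_sum fun u _ => ih fun l hl => ?_)
      (Nat.cast_nonneg n)
    exact h _ (by simp [hl])

theorem drawMean_congr {m : ℕ} {f g : List (Fin n) → ℝ} (h : ∀ l, l.length = m → f l = g l) :
    drawMean m f = drawMean m g :=
  le_antisymm (drawMean_mono fun l hl => (h l hl).le) (drawMean_mono fun l hl => (h l hl).ge)

theorem drawMean_add (m : ℕ) (f g : List (Fin n) → ℝ) :
    drawMean m (fun l => f l + g l) = drawMean m f + drawMean m g := by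
  induction m generalizing f g with
  | zero => rfl
  | succ m ih => simp only [drawMean, ih, Finset.sum_add_distrib, add_div]

theorem drawMean_const_mul (m : ℕ) (c : ℝ) (f : List (Fin n) → ℝ) :
    drawMean m (fun l => c * f l) = c * drawMean m f := by
  induction m generalizing f with
  | zero => rfl
  | succ m ih => simp only [drawMean, ih, ← Finset.mul_sum, mul_div_assoc]

theorem drawMean_const [NeZero n] (m : ℕ) (c : ℝ) : drawMean m (fun _ : List (Fin n) => c) = c := by
  induction m with
  | zero => rfl
  | succ m ih =>
    have : (n : ℝ) ≠ 0 := Nat.cast_ne_zero.2 (NeZero.ne n)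
    simp only [drawMean, ih]
    simp [this]

theorem drawMean_append (a b : ℕ) (f : List (Fin n) → ℝ) :
    drawMean (a + b) f = drawMean a fun l => drawMean b fun l' => f (l ++ l') := by
  induction a generalizing f with
  | zero => simp [drawMean]
  | succ a ih => simp only [Nat.add_right_comm a 1 b, drawMean, ih, List.cons_append]

theorem drawMean_nonneg {m : ℕ} {f : List (Fin n) → ℝ} (h : ∀ l, 0 ≤ f l) : 0 ≤ drawMean m f := by
  induction m generalizing f with
  | zero => exact h []
  | succ m ih => exact div_nonneg (Finset.sum_nonneg fun u _ => ih fun l => h _) (Nat.cast_nonneg n)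

theorem drawMean_eq_sum (m : ℕ) (f : List (Fin n) → ℝ) :
    drawMean m f = (∑ g : Fin m → Fin n, f (List.ofFn g)) / (n : ℝ) ^ m := by
  induction m generalizing f with
  | zero => simp [drawMean]
  | succ m ih =>
    simp only [drawMean, ih]
    rw [← Finset.sum_div, div_div, ← pow_succ, ← (Fin.consEquiv fun _ => Fin n).sum_comp,
      Fintype.sum_prod_type]
    simp [Fin.consEquiv, List.ofFn_succ]

/-- The entries `d, …, d + m - 1` of a tape. -/
def stretch (ω : ℕ → Fin n) (d m : ℕ) : List (Fin n) := (List.range' d m).map ω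

@[simp] theorem length_stretch (ω : ℕ → Fin n) (d m : ℕ) : (stretch ω d m).length = m := by
  simp [stretch]

theorem stretch_add (ω : ℕ → Fin n) (d a b : ℕ) :
    stretch ω d (a + b) = stretch ω d a ++ stretch ω (d + a) b := by
  simp [stretch, ← List.map_append, List.range'_append_1]

theorem stretch_zero_eq_ofFn (ω : ℕ → Fin n) (m : ℕ) :
    stretch ω 0 m = List.ofFn fun i : Fin m => ω i := by
  refine List.ext_getElem (by simp) fun i h₁ h₂ => ?_
  simp [stretch]

theorem tapeLaw_prefix [NeZero n] (m : ℕ) (F : List (Fin n) → Prop) :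
    (tapeLaw n).real {ω | F (stretch ω 0 m)} = drawMean m fun l => ind (F l) := by
  classical
  have hcyl : ∀ g : Fin m → Fin n,
      (tapeLaw n).real {ω | (fun i : Fin m => ω i) = g} = 1 / (n : ℝ) ^ m := by
    intro g
    have e : {ω : ℕ → Fin n | (fun i : Fin m => ω i) = g}
        = Set.pi (Finset.range m : Set ℕ)
          (fun i => if h : i < m then ({g ⟨i, h⟩} : Set (Fin n)) else Set.univ) := by
      ext ω
      simp only [Set.mem_ofPred_eq, Set.mem_pi, Finset.coe_range, Set.mem_Iio, funext_iff]
      constructor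
      · intro h i hi
        simp [hi, ← h ⟨i, hi⟩]
      · intro h i
        simpa using h i i.2
    have h1 : ∀ u : Fin n, (PMF.uniformOfFintype (Fin n)).toMeasure {u} = (n : ENNReal)⁻¹ := by
      intro u
      rw [PMF.toMeasure_apply_singleton _ _ (measurableSet_singleton u)]
      simp
    rw [Measure.real, e, tapeLaw, Measure.infinitePi_pi]
    · rw [Finset.prod_congr rfl (g := fun _ => (n : ENNReal)⁻¹)]
      · simp
      · intro i hi
        rw [dif_pos (Finset.mem_range.1 hi), h1]
    · intro i hi
      rw [dif_pos (Finset.mem_range.1 hi)]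
      exact measurableSet_singleton _
  have hmeas : ∀ g : Fin m → Fin n,
      MeasurableSet {ω : ℕ → Fin n | (fun i : Fin m => ω i) = g} := by
    intro g
    have : Measurable fun (ω : ℕ → Fin n) (i : Fin m) => ω i :=
      measurable_pi_lambda _ fun i => measurable_pi_apply _
    exact this (measurableSet_singleton g)
  have hset : {ω : ℕ → Fin n | F (stretch ω 0 m)}
      = ⋃ g ∈ Finset.univ.filter (fun g : Fin m → Fin n => F (List.ofFn g)),
        {ω : ℕ → Fin n | (fun i : Fin m => ω i) = g} := by
    ext ω
    simp [stretch_zero_eq_ofFn]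
  have : IsProbabilityMeasure (tapeLaw n) := by unfold tapeLaw; infer_instance
  rw [hset, measureReal_biUnion_finset _ fun g _ => hmeas g]
  · simp only [hcyl]
    rw [drawMean_eq_sum, Finset.sum_div, Finset.sum_filter]
    refine Finset.sum_congr rfl fun g _ => ?_
    by_cases h : F (List.ofFn g) <;> simp [ind, h]
  · intro g _ g' _ hne
    refine Set.disjoint_left.2 fun ω h h' => hne ?_
    exact h.symm.trans h'

/-- The `j`-th block of length `T` of a list. -/
def window {α : Type*} (T j : ℕ) (l : List α) : List α := (l.drop (j * T)).take T

theorem window_stretch (ω : ℕ → Fin n) (T : ℕ) {J j : ℕ} (hj : j < J) :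
    window T j (stretch ω 0 (J * T)) = stretch ω (j * T) T := by
  obtain ⟨r, rfl⟩ : ∃ r, J = j + 1 + r := ⟨J - (j + 1), by omega⟩
  have e : (j + 1 + r) * T = j * T + (T + r * T) := by ring
  rw [e, stretch_add, stretch_add, window, List.drop_left' (by simp), List.take_left' (by simp),
    Nat.zero_add]

theorem window_append_of_lt {α : Type*} {T J j : ℕ} (hj : j < J) {l l' : List α}
    (hl : l.length = J * T) : window T j (l ++ l') = window T j l := by
  have h1 : j * T + T ≤ J * T := by
    have := Nat.mul_le_mul_right T (Nat.succ_le_of_lt hj)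
    rwa [Nat.succ_mul] at this
  rw [window, window, List.drop_append_of_le_length (by omega),
    List.take_append_of_le_length (by rw [List.length_drop]; omega)]

theorem window_append_self {α : Type*} {T J : ℕ} {l l' : List α} (hl : l.length = J * T)
    (hl' : l'.length = T) : window T J (l ++ l') = l' := by
  rw [window, List.drop_left' hl, List.take_of_length_le hl'.le]

/-- Disjoint blocks of the tape are independent. -/
theorem drawMean_prod_window (T J : ℕ) (f : List (Fin n) → ℝ) :
    drawMean (J * T) (fun l => ∏ j ∈ Finset.range J, f (window T j l)) = drawMean T f ^ J := by
  induction J with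
  | zero => simp [drawMean]
  | succ J ih =>
    rw [Nat.succ_mul, drawMean_append, pow_succ', ← ih, ← drawMean_const_mul]
    refine drawMean_congr fun l hl => ?_
    rw [mul_comm (drawMean T f), ← drawMean_const_mul]
    refine drawMean_congr fun l' hl' => ?_
    rw [Finset.prod_range_succ, window_append_self hl hl']
    congr 1
    exact Finset.prod_congr rfl fun j hj => by
      rw [window_append_of_lt (Finset.mem_range.1 hj) hl]

theorem drawMean_sum_window [NeZero n] (T J : ℕ) (f : List (Fin n) → ℝ) :
    drawMean (J * T) (fun l => ∑ j ∈ Finset.range J, f (window T j l)) = J * drawMean T f := by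
  induction J with
  | zero => simp [drawMean]
  | succ J ih =>
    have h : drawMean ((J + 1) * T) (fun l => ∑ j ∈ Finset.range (J + 1), f (window T j l))
        = drawMean (J * T) (fun l => ∑ j ∈ Finset.range J, f (window T j l) + drawMean T f) := by
      rw [Nat.succ_mul, drawMean_append]
      refine drawMean_congr fun l hl => ?_
      have : ∑ j ∈ Finset.range J, f (window T j l)
          = drawMean T fun _ : List (Fin n) => ∑ j ∈ Finset.range J, f (window T j l) :=
        (drawMean_const T _).symm
      rw [this, ← drawMean_add]
      refine drawMean_congr fun l' hl' => ?_
      rw [Finset.sum_range_succ, window_append_self hl hl']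
      congr 1
      exact Finset.sum_congr rfl fun j hj => by
        rw [window_append_of_lt (Finset.mem_range.1 hj) hl]
    rw [h, drawMean_add, ih, drawMean_const]
    push_cast
    ring

theorem drawMean_markov (m : ℕ) (f : List (Fin n) → ℝ) (hf : ∀ l, 0 ≤ f l) (τ : ℝ) :
    τ * drawMean m (fun l => ind (τ < f l)) ≤ drawMean m f := by
  rw [← drawMean_const_mul]
  refine drawMean_mono fun l _ => ?_
  by_cases h : τ < f l
  · rw [ind_true h, mul_one]; exact h.le
  · rw [ind_false h, mul_zero]; exact hf l

/-! ### Counting the errors in a sample of pairs -/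

/-- The number of pairs with the property `g` when the entries of a list are paired up. -/
noncomputable def countPairs (g : Fin n → Fin n → Prop) : List (Fin n) → ℕ
  | x :: y :: l => (haveI := Classical.propDecidable; if g x y then 1 else 0) + countPairs g l
  | _ => 0

theorem countPairs_cons (g : Fin n → Fin n → Prop) (x y : Fin n) (l : List (Fin n)) :
    (countPairs g (x :: y :: l) : ℝ) = ind (g x y) + countPairs g l := by
  rw [countPairs, ind]
  push_cast
  rfl

theorem drawMean_two_mul_succ (s : ℕ) (f : List (Fin n) → ℝ) :
    drawMean (2 * (s + 1)) f
      = (∑ x, ∑ y, drawMean (2 * s) fun l => f (x :: y :: l)) / (n : ℝ) ^ 2 := by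
  have : 2 * (s + 1) = 2 * s + 1 + 1 := by ring
  rw [this]
  simp only [drawMean]
  rw [← Finset.sum_div, div_div, pow_two]

/-- The probability that a random pair has the property `g`. -/
noncomputable def pairDensity (g : Fin n → Fin n → Prop) : ℝ :=
  (∑ x, ∑ y, ind (g x y)) / (n : ℝ) ^ 2

theorem drawMean_countPairs [NeZero n] (g : Fin n → Fin n → Prop) (s : ℕ) :
    drawMean (2 * s) (fun l => (countPairs g l : ℝ)) = s * pairDensity g := by
  have hn : (n : ℝ) ≠ 0 := Nat.cast_ne_zero.2 (NeZero.ne n)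
  induction s with
  | zero => simp [drawMean, countPairs]
  | succ s ih =>
    rw [drawMean_two_mul_succ]
    simp only [countPairs_cons, drawMean_add, drawMean_const, ih, Finset.sum_add_distrib, add_div]
    simp only [Finset.sum_const, Finset.card_univ, Fintype.card_fin, nsmul_eq_mul]
    rw [← pairDensity]
    push_cast
    field_simp
    ring

theorem drawMean_countPairs_sq [NeZero n] (g : Fin n → Fin n → Prop) (s : ℕ) :
    drawMean (2 * s) (fun l => ((countPairs g l : ℝ) - s * pairDensity g) ^ 2)
      = s * (pairDensity g * (1 - pairDensity g)) := by
  have hn : (n : ℝ) ≠ 0 := Nat.cast_ne_zero.2 (NeZero.ne n)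
  set p := pairDensity g with hp
  induction s with
  | zero => simp [drawMean, countPairs]
  | succ s ih =>
    have h1 : drawMean (2 * s) (fun l => (countPairs g l : ℝ) - s * p) = 0 := by
      have := drawMean_add (2 * s) (fun l => (countPairs g l : ℝ)) (fun _ => - (s * p))
      simp only [← sub_eq_add_neg] at this
      rw [this, drawMean_const, drawMean_countPairs]
      ring
    have h2 : ∀ x y, drawMean (2 * s)
        (fun l => ((countPairs g (x :: y :: l) : ℝ) - (s + 1 : ℕ) * p) ^ 2)
        = s * (p * (1 - p)) + (ind (g x y) - p) ^ 2 := by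
      intro x y
      have : ∀ l, ((countPairs g (x :: y :: l) : ℝ) - (s + 1 : ℕ) * p) ^ 2
          = ((countPairs g l : ℝ) - s * p) ^ 2
            + (2 * (ind (g x y) - p) * ((countPairs g l : ℝ) - s * p) + (ind (g x y) - p) ^ 2) := by
        intro l
        rw [countPairs_cons]
        push_cast
        ring
      simp only [this, drawMean_add, drawMean_const_mul, drawMean_const, ih, h1]
      ring
    have h3 : ∀ x y, (ind (g x y) - p) ^ 2 = (1 - 2 * p) * ind (g x y) + p ^ 2 := by
      intro x y
      by_cases h : g x y
      · rw [ind_true h]; ring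
      · rw [ind_false h]; ring
    rw [drawMean_two_mul_succ]
    simp only [h2, h3, Finset.sum_add_distrib, ← Finset.mul_sum]
    simp only [Finset.sum_const, Finset.card_univ, Fintype.card_fin, nsmul_eq_mul]
    have h4 : ∑ x, ∑ y, ind (g x y) = p * (n : ℝ) ^ 2 := by
      rw [hp, pairDensity]; field_simp
    rw [h4]
    push_cast
    field_simp
    ring

/-- Chebyshev's inequality for the lower tail of the count. -/
theorem drawMean_countPairs_low [NeZero n] (g : Fin n → Fin n → Prop) {s : ℕ} (hs : 0 < s)
    {τ p₀ : ℝ} (hp₀ : 0 < p₀) (hp : p₀ ≤ pairDensity g) (hτ : τ ≤ 5 / 6 * (s * pairDensity g)) :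
    drawMean (2 * s) (fun l => ind ((countPairs g l : ℝ) ≤ τ)) ≤ 36 / (s * p₀) := by
  have hs0 : (0 : ℝ) < s := by exact_mod_cast hs
  have hpos : 0 < s * pairDensity g := by
    have := hp₀.trans_le hp
    positivity
  have h1 : (s * pairDensity g / 6) ^ 2 * drawMean (2 * s) (fun l => ind ((countPairs g l : ℝ) ≤ τ))
      ≤ s * pairDensity g := by
    rw [← drawMean_const_mul]
    have h2 : s * (pairDensity g * (1 - pairDensity g)) ≤ s * pairDensity g := by
      have := sq_nonneg (pairDensity g)
      nlinarith
    refine (drawMean_mono fun l _ => ?_).trans ((drawMean_countPairs_sq g s).le.trans h2)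
    by_cases h : (countPairs g l : ℝ) ≤ τ
    · rw [ind_true h, mul_one, ← neg_sq ((countPairs g l : ℝ) - _)]
      gcongr
      linarith
    · rw [ind_false h, mul_zero]
      exact sq_nonneg _
  have h2 : drawMean (2 * s) (fun l => ind ((countPairs g l : ℝ) ≤ τ))
      ≤ 36 / (s * pairDensity g) := by
    rw [le_div_iff₀ hpos]
    have : (s * pairDensity g / 6) ^ 2 *
        drawMean (2 * s) (fun l => ind ((countPairs g l : ℝ) ≤ τ))
        = (s * pairDensity g) * (drawMean (2 * s) (fun l => ind ((countPairs g l : ℝ) ≤ τ))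
          * (s * pairDensity g) / 36) := by ring
    rw [this] at h1
    have := le_of_mul_le_mul_left (h1.trans (mul_one _).symm.le) hpos
    linarith
  refine h2.trans ?_
  gcongr

end Tape

/-! ### Pivot clustering -/

section Pivot

variable {n : ℕ} (G : SimpleGraph (Fin n))

open Classical in
/-- The label of a vertex with respect to a list of pivots: the first pivot near it, and the vertex
itself if there is none. -/
noncomputable def pivotLabel : List (Fin n) → Fin n → Fin n
  | [], x => x
  | y :: P, x => if Near G x y then y else pivotLabel P x

/-- No pivot is near `x`. -/
def Uncovered (P : List (Fin n)) (x : Fin n) : Prop := ∀ y ∈ P, ¬ Near G x y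

open Classical in
/-- A drawn vertex becomes a pivot if it is its own label.  A vertex that already is a pivot may be
added again, without any effect on the labels. -/
noncomputable def addPivot (P : List (Fin n)) (u : Fin n) : List (Fin n) :=
  if pivotLabel G P u = u then P ++ [u] else P

/-- The list of pivots after the vertices of a list have been drawn. -/
noncomputable def pivots (P l : List (Fin n)) : List (Fin n) := l.foldl (addPivot G) P

/-- The clustering defined by a list of pivots. -/
noncomputable def pivotClustering (P : List (Fin n)) (x : Fin n) : ℕ := pivotLabel G P x

variable {G}

theorem near_self (x : Fin n) : Near G x x := Or.inl rfl

theorem Uncovered.pivotLabel_eq {P : List (Fin n)} {x : Fin n} (h : Uncovered G P x) :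
    pivotLabel G P x = x := by
  induction P with
  | nil => rfl
  | cons y P ih =>
    rw [pivotLabel, if_neg (h y (by simp)), ih fun z hz => h z (by simp [hz])]

theorem pivotLabel_mem {P : List (Fin n)} {x : Fin n} (h : ¬ Uncovered G P x) :
    pivotLabel G P x ∈ P := by
  induction P with
  | nil => exact absurd (fun y hy => by simp at hy) h
  | cons y P ih =>
    rw [pivotLabel]
    split_ifs with hxy
    · simp
    · refine List.mem_cons_of_mem _ (ih fun h' => h ?_)
      intro z hz
      rcases List.mem_cons.1 hz with rfl | hz
      · exact hxy
      · exact h' z hz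

theorem pivotLabel_append {P : List (Fin n)} {u x : Fin n} (h : ¬ Uncovered G P x) :
    pivotLabel G (P ++ [u]) x = pivotLabel G P x := by
  induction P with
  | nil => exact absurd (fun y hy => by simp at hy) h
  | cons y P ih =>
    rw [List.cons_append, pivotLabel, pivotLabel]
    split_ifs with hxy
    · rfl
    · refine ih fun h' => h ?_
      intro z hz
      rcases List.mem_cons.1 hz with rfl | hz
      · exact hxy
      · exact h' z hz

open Classical in
theorem Uncovered.pivotLabel_append {P : List (Fin n)} {u x : Fin n} (h : Uncovered G P x) :
    pivotLabel G (P ++ [u]) x = if Near G x u then u else x := by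
  induction P with
  | nil => rfl
  | cons y P ih =>
    rw [List.cons_append, pivotLabel, if_neg (h y (by simp)), ih fun z hz => h z (by simp [hz])]

theorem uncovered_append {P : List (Fin n)} {u x : Fin n} :
    Uncovered G (P ++ [u]) x ↔ Uncovered G P x ∧ ¬ Near G x u := by
  simp [Uncovered, or_imp, forall_and]

/-- A vertex that is covered but is its own label is a pivot, so it does not cover anything new. -/
theorem near_of_covered {P : List (Fin n)} {u x : Fin n} (hu : ¬ Uncovered G P u)
    (hl : pivotLabel G P u = u) (hx : Uncovered G P x) : ¬ Near G x u :=
  hx u (hl ▸ pivotLabel_mem hu)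

theorem pivotLabel_addPivot_of_covered {P : List (Fin n)} {u : Fin n} (hu : ¬ Uncovered G P u)
    (x : Fin n) : pivotLabel G (addPivot G P u) x = pivotLabel G P x := by
  unfold addPivot
  split_ifs with hl
  · by_cases hx : Uncovered G P x
    · rw [hx.pivotLabel_append, if_neg (near_of_covered hu hl hx), hx.pivotLabel_eq]
    · rw [pivotLabel_append hx]
  · rfl

theorem uncovered_addPivot_of_covered {P : List (Fin n)} {u : Fin n} (hu : ¬ Uncovered G P u)
    (x : Fin n) : Uncovered G (addPivot G P u) x ↔ Uncovered G P x := by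
  unfold addPivot
  split_ifs with hl
  · rw [uncovered_append]
    exact ⟨fun h => h.1, fun h => ⟨h, near_of_covered hu hl h⟩⟩
  · rfl

theorem Uncovered.addPivot_eq {P : List (Fin n)} {u : Fin n} (hu : Uncovered G P u) :
    addPivot G P u = P ++ [u] := if_pos hu.pivotLabel_eq

theorem Uncovered.of_addPivot {P : List (Fin n)} {u x : Fin n}
    (h : Uncovered G (addPivot G P u) x) : Uncovered G P x := by
  by_cases hu : Uncovered G P u
  · rw [hu.addPivot_eq, uncovered_append] at h
    exact h.1
  · rwa [uncovered_addPivot_of_covered hu] at h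

variable (G)

/-- Exactly two of the three pairs of vertices are near. -/
def BadTriple (u x y : Fin n) : Prop :=
  (Near G u x ∧ Near G u y ∧ ¬ Near G x y) ∨ (Near G u x ∧ ¬ Near G u y ∧ Near G x y) ∨
    (¬ Near G u x ∧ Near G u y ∧ Near G x y)

variable {G}

theorem badTriple_swap {u x y : Fin n} : BadTriple G u x y ↔ BadTriple G x u y := by
  simp only [BadTriple, near_comm (x := u) (y := x)]
  tauto

theorem badTriple_swap' {u x y : Fin n} : BadTriple G u x y ↔ BadTriple G u y x := by
  simp only [BadTriple, near_comm (x := x) (y := y)]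
  tauto

/-- Every clustering errs inside a bad triple, since having equal labels is transitive. -/
theorem BadTriple.errs {u x y : Fin n} (h : BadTriple G u x y) (cl : Fin n → ℕ) :
    Errs G cl x y ∨ Errs G cl u x ∨ Errs G cl u y := by
  unfold BadTriple at h
  unfold Errs
  by_contra! hc
  obtain ⟨h1, h2, h3⟩ := hc
  rw [h1, h2, h3] at h
  grind

variable (G)

/-- Twice the number of errors at pairs that are not both uncovered. -/
noncomputable def settledCost (P : List (Fin n)) : ℝ :=
  ∑ x, ∑ y, ind (¬ (Uncovered G P x ∧ Uncovered G P y) ∧ Errs G (pivotClustering G P) x y)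

/-- Twice the number of errors of `cl` at pairs of uncovered vertices. -/
noncomputable def openCost (cl : Fin n → ℕ) (P : List (Fin n)) : ℝ :=
  ∑ x, ∑ y, ind ((Uncovered G P x ∧ Uncovered G P y) ∧ Errs G cl x y)

/-- Twice the number of positive edges between uncovered vertices. -/
noncomputable def openEdges (P : List (Fin n)) : ℝ :=
  ∑ x, ∑ y, ind ((Uncovered G P x ∧ Uncovered G P y) ∧ G.Adj x y)

/-- The number of uncovered vertices. -/
noncomputable def openCount (P : List (Fin n)) : ℝ := ∑ x, ind (Uncovered G P x)

variable {G}

theorem two_mul_disagreements_pivotClustering (P : List (Fin n)) :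
    2 * (disagreements G (pivotClustering G P) : ℝ) = settledCost G P + openEdges G P := by
  rw [two_mul_disagreements, settledCost, openEdges]
  simp only [← Finset.sum_add_distrib]
  refine Finset.sum_congr rfl fun x _ => Finset.sum_congr rfl fun y _ => ?_
  by_cases h : Uncovered G P x ∧ Uncovered G P y
  · rw [ind_false (p := ¬ _ ∧ _) (fun h' => h'.1 h), zero_add]
    refine ind_congr ?_
    have : (pivotClustering G P x = pivotClustering G P y) ↔ x = y := by
      rw [pivotClustering, pivotClustering, h.1.pivotLabel_eq, h.2.pivotLabel_eq, Fin.val_inj]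
    rw [Errs, this, Near, and_iff_right h]
    by_cases hxy : x = y
    · simp [hxy]
    · simp [hxy]
  · rw [ind_false (p := _ ∧ G.Adj x y) (fun h' => h h'.1), add_zero]
    exact ind_congr (by simp [h])

theorem settledCost_addPivot_le {P : List (Fin n)} {u : Fin n} (hu : Uncovered G P u) :
    settledCost G (addPivot G P u) ≤ settledCost G P
      + ∑ x, ∑ y, ind ((Uncovered G P x ∧ Uncovered G P y) ∧ BadTriple G u x y) := by
  rw [hu.addPivot_eq, settledCost, settledCost]
  simp only [← Finset.sum_add_distrib]
  refine Finset.sum_le_sum fun x _ => Finset.sum_le_sum fun y _ => ?_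
  refine (ind_mono ?_).trans (ind_or_le _ _)
  rintro ⟨h1, h2⟩
  simp only [uncovered_append] at h1
  simp only [Errs, pivotClustering, Fin.val_inj] at h2 ⊢
  by_cases hx : Uncovered G P x <;> by_cases hy : Uncovered G P y
  · refine Or.inr ⟨⟨hx, hy⟩, ?_⟩
    rw [hx.pivotLabel_append, hy.pivotLabel_append] at h2
    unfold BadTriple
    rw [near_comm (x := u), near_comm (x := u)]
    by_cases hxu : Near G x u <;> by_cases hyu : Near G y u
    · simp_all
    · have : u ≠ y := by rintro rfl; exact hyu (near_self u)
      simp_all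
    · have : x ≠ u := by rintro rfl; exact hxu (near_self x)
      simp_all
    · exact absurd ⟨⟨hx, hxu⟩, hy, hyu⟩ h1
  · refine Or.inl ⟨fun h => hy h.2, ?_⟩
    have hp := pivotLabel_mem hy
    rw [hx.pivotLabel_append, pivotLabel_append hy] at h2
    rw [hx.pivotLabel_eq]
    have e1 : x ≠ pivotLabel G P y := fun h => hx _ hp (h ▸ near_self x)
    have e2 : u ≠ pivotLabel G P y := fun h => hu _ hp (h ▸ near_self u)
    split_ifs at h2 <;> simp_all
  · refine Or.inl ⟨fun h => hx h.1, ?_⟩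
    have hp := pivotLabel_mem hx
    rw [hy.pivotLabel_append, pivotLabel_append hx] at h2
    rw [hy.pivotLabel_eq]
    have e1 : pivotLabel G P x ≠ y := fun h => hy _ hp (by rw [h]; exact near_self y)
    have e2 : pivotLabel G P x ≠ u := fun h => hu _ hp (by rw [h]; exact near_self u)
    split_ifs at h2 <;> simp_all
  · rw [pivotLabel_append hx, pivotLabel_append hy] at h2
    exact Or.inl ⟨fun h => hx h.1, h2⟩

theorem openCost_addPivot_add_le {P : List (Fin n)} {u : Fin n} (hu : Uncovered G P u)
    (cl : Fin n → ℕ) : openCost G cl (addPivot G P u)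
      + ∑ x, ∑ y, ind (((Uncovered G P x ∧ Uncovered G P y) ∧ BadTriple G u x y) ∧ Errs G cl x y)
      ≤ openCost G cl P := by
  rw [hu.addPivot_eq, openCost, openCost]
  simp only [← Finset.sum_add_distrib]
  refine Finset.sum_le_sum fun x _ => Finset.sum_le_sum fun y _ => ?_
  by_cases hb : BadTriple G u x y
  · rw [ind_false (p := (Uncovered G (P ++ [u]) x ∧ _) ∧ _), zero_add]
    · exact ind_mono fun h => ⟨h.1.1, h.2⟩
    · simp only [uncovered_append]
      unfold BadTriple at hb
      rw [near_comm (x := u), near_comm (x := u)] at hb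
      tauto
  · rw [ind_false (p := (_ ∧ BadTriple G u x y) ∧ _) (fun h => hb h.1.2), add_zero]
    refine ind_mono fun h => ?_
    simp only [uncovered_append] at h
    exact ⟨⟨h.1.1.1, h.1.2.1⟩, h.2⟩

/-- Charging the three errors that a bad triple can cause to the error of `cl` inside it. -/
theorem sum_badTriple_le (R : Fin n → Prop) (cl : Fin n → ℕ) :
    ∑ u, ∑ x, ∑ y, ind (R u) * ind ((R x ∧ R y) ∧ BadTriple G u x y)
      ≤ 3 * ∑ u, ∑ x, ∑ y,
        ind (R u) * ind (((R x ∧ R y) ∧ BadTriple G u x y) ∧ Errs G cl x y) := by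
  set f : Fin n → Fin n → Fin n → ℝ :=
    fun u x y => ind (R u) * ind (((R x ∧ R y) ∧ BadTriple G u x y) ∧ Errs G cl x y) with hf
  have h : ∀ u x y, ind (R u) * ind ((R x ∧ R y) ∧ BadTriple G u x y)
      ≤ f u x y + (f y u x + f x u y) := by
    intro u x y
    simp only [hf, ← ind_and]
    refine (ind_mono ?_).trans ((ind_or_le _ _).trans (add_le_add le_rfl (ind_or_le _ _)))
    rintro ⟨h1, ⟨h2, h3⟩, h4⟩
    rcases h4.errs cl with h | h | h
    · exact Or.inl ⟨h1, ⟨⟨h2, h3⟩, h4⟩, h⟩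
    · exact Or.inr (Or.inl ⟨h3, ⟨⟨h1, h2⟩, badTriple_swap.1 (badTriple_swap'.1 h4)⟩, h⟩)
    · exact Or.inr (Or.inr ⟨h2, ⟨⟨h1, h3⟩, badTriple_swap.1 h4⟩, h⟩)
  refine (Finset.sum_le_sum fun u _ => Finset.sum_le_sum fun x _ =>
    Finset.sum_le_sum fun y _ => h u x y).trans (le_of_eq ?_)
  simp only [Finset.sum_add_distrib]
  have e1 : ∑ u, ∑ x, ∑ y, f x u y = ∑ u, ∑ x, ∑ y, f u x y := Finset.sum_comm
  have e2 : ∑ u, ∑ x, ∑ y, f y u x = ∑ u, ∑ x, ∑ y, f u x y := by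
    rw [← e1]
    exact Finset.sum_congr rfl fun u _ => Finset.sum_comm
  rw [e1, e2]
  ring

/-- The potential `settledCost + 3 * openCost` does not increase in expectation. -/
theorem sum_potential_le (P : List (Fin n)) (cl : Fin n → ℕ) :
    ∑ u, (settledCost G (addPivot G P u) + 3 * openCost G cl (addPivot G P u))
      ≤ n * (settledCost G P + 3 * openCost G cl P) := by
  have h : ∀ u, settledCost G (addPivot G P u) + 3 * openCost G cl (addPivot G P u)
      ≤ settledCost G P + 3 * openCost G cl P
        + (∑ x, ∑ y, ind (Uncovered G P u) *
            ind ((Uncovered G P x ∧ Uncovered G P y) ∧ BadTriple G u x y)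
          - 3 * ∑ x, ∑ y, ind (Uncovered G P u) *
            ind (((Uncovered G P x ∧ Uncovered G P y) ∧ BadTriple G u x y) ∧ Errs G cl x y)) := by
    intro u
    by_cases hu : Uncovered G P u
    · have h1 := settledCost_addPivot_le hu
      have h2 := openCost_addPivot_add_le hu cl
      simp only [ind_true hu, one_mul]
      linarith
    · simp only [ind_false hu, zero_mul, Finset.sum_const_zero, mul_zero, sub_zero, add_zero,
        settledCost, openCost, uncovered_addPivot_of_covered hu, Errs, pivotClustering,
        pivotLabel_addPivot_of_covered hu]
      rfl
  refine (Finset.sum_le_sum fun u _ => h u).trans ?_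
  rw [Finset.sum_add_distrib, Finset.sum_sub_distrib, ← Finset.mul_sum]
  have := sum_badTriple_le (G := G) (Uncovered G P) cl
  simp only [Finset.sum_const, Finset.card_univ, Fintype.card_fin, nsmul_eq_mul]
  linarith

theorem drawMean_potential_le [NeZero n] (m : ℕ) (P : List (Fin n)) (cl : Fin n → ℕ) :
    drawMean m (fun l => settledCost G (pivots G P l) + 3 * openCost G cl (pivots G P l))
      ≤ settledCost G P + 3 * openCost G cl P := by
  induction m generalizing P with
  | zero => rfl
  | succ m ih =>
    have hn : (0 : ℝ) < n := Nat.cast_pos.2 (NeZero.pos n)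
    simp only [drawMean, pivots, List.foldl_cons]
    rw [div_le_iff₀ hn, mul_comm]
    exact (Finset.sum_le_sum fun u _ => ih _).trans (sum_potential_le P cl)

theorem openEdges_addPivot_le (P : List (Fin n)) (u : Fin n) :
    openEdges G (addPivot G P u) ≤ openEdges G P :=
  Finset.sum_le_sum fun _ _ => Finset.sum_le_sum fun _ _ =>
    ind_mono fun h => ⟨⟨h.1.1.of_addPivot, h.1.2.of_addPivot⟩, h.2⟩

theorem openEdges_pivots_le (P l : List (Fin n)) : openEdges G (pivots G P l) ≤ openEdges G P := by
  induction l generalizing P with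
  | nil => rfl
  | cons u l ih => exact (ih _).trans (openEdges_addPivot_le P u)

/-- A drawn vertex covers, on average, at least `openEdges / n` new vertices: an uncovered vertex
covers all its uncovered neighbours. -/
theorem sum_openCount_add_le (P : List (Fin n)) :
    ∑ u, openCount G (addPivot G P u) + openEdges G P ≤ n * openCount G P := by
  have h : ∀ u, openCount G (addPivot G P u)
      + ∑ x, ind ((Uncovered G P u ∧ Uncovered G P x) ∧ G.Adj u x) ≤ openCount G P := by
    intro u
    simp only [openCount, ← Finset.sum_add_distrib]
    refine Finset.sum_le_sum fun x _ => ?_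
    by_cases h : (Uncovered G P u ∧ Uncovered G P x) ∧ G.Adj u x
    · have : ¬ Uncovered G (addPivot G P u) x := by
        rw [h.1.1.addPivot_eq, uncovered_append]
        exact fun h' => h'.2 (Or.inr h.2.symm)
      rw [ind_true h, ind_false this, ind_true h.1.2, zero_add]
    · rw [ind_false h, add_zero]
      exact ind_mono Uncovered.of_addPivot
  have := Finset.sum_le_sum fun u (_ : u ∈ Finset.univ) => h u
  rw [Finset.sum_add_distrib] at this
  simpa [openEdges] using this

theorem mul_drawMean_openEdges_le [NeZero n] (m : ℕ) (P : List (Fin n)) :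
    m * drawMean m (fun l => openEdges G (pivots G P l)) ≤ n * openCount G P := by
  have hn : (0 : ℝ) < n := Nat.cast_pos.2 (NeZero.pos n)
  induction m generalizing P with
  | zero =>
    simp only [Nat.cast_zero, zero_mul]
    exact mul_nonneg hn.le (Finset.sum_nonneg fun _ _ => ind_nonneg _)
  | succ m ih =>
    have h1 : drawMean (m + 1) (fun l => openEdges G (pivots G P l)) ≤ openEdges G P :=
      (drawMean_mono fun l _ => openEdges_pivots_le P l).trans (drawMean_const _ _).le
    have h2 : m * drawMean (m + 1) (fun l => openEdges G (pivots G P l))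
        ≤ ∑ u, openCount G (addPivot G P u) := by
      simp only [drawMean, pivots, List.foldl_cons]
      rw [← mul_div_assoc, div_le_iff₀ hn, Finset.mul_sum, Finset.sum_mul]
      refine Finset.sum_le_sum fun u _ => ?_
      rw [mul_comm _ (n : ℝ)]
      exact ih _
    have h3 := sum_openCount_add_le (G := G) P
    push_cast
    linarith

theorem exists_disagreements_eq_optCost (G : SimpleGraph (Fin n)) :
    ∃ cl, disagreements G cl = optCost G :=
  Nat.sInf_mem (Set.range_nonempty (disagreements G))

/-- The expected cost of pivot clustering with `m` draws is at most `3 * OPT + n ^ 2 / (2 * m)`. -/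
theorem drawMean_disagreements_le [NeZero n] (G : SimpleGraph (Fin n)) {m : ℕ} (hm : 0 < m) :
    drawMean m (fun l => 2 * (disagreements G (pivotClustering G (pivots G [] l)) : ℝ))
      ≤ 6 * optCost G + (n : ℝ) ^ 2 / m := by
  obtain ⟨cl, hcl⟩ := exists_disagreements_eq_optCost G
  have hm0 : (0 : ℝ) < m := by exact_mod_cast hm
  have h1 := drawMean_potential_le (G := G) m [] cl
  have h2 := mul_drawMean_openEdges_le (G := G) m []
  have hunc : ∀ x, Uncovered G [] x := fun x y hy => by simp at hy
  have e1 : settledCost G [] = 0 := by simp [settledCost, hunc, ind]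
  have e2 : openCost G cl [] = 2 * optCost G := by
    rw [← hcl, two_mul_disagreements]
    simp [openCost, hunc]
  have e3 : openCount G [] = n := by simp [openCount, hunc, ind]
  rw [e1, e2] at h1
  rw [e3] at h2
  have h3 : drawMean m (fun l => openEdges G (pivots G [] l)) ≤ (n : ℝ) ^ 2 / m := by
    rw [le_div_iff₀ hm0]
    linarith
  have h4 : drawMean m (fun l => 2 * (disagreements G (pivotClustering G (pivots G [] l)) : ℝ))
      ≤ drawMean m (fun l => (settledCost G (pivots G [] l) + 3 * openCost G cl (pivots G [] l))
        + openEdges G (pivots G [] l)) := by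
    refine drawMean_mono fun l _ => ?_
    rw [two_mul_disagreements_pivotClustering]
    have : 0 ≤ openCost G cl (pivots G [] l) :=
      Finset.sum_nonneg fun _ _ => Finset.sum_nonneg fun _ _ => ind_nonneg _
    linarith
  rw [drawMean_add] at h4
  linarith

end Pivot

/-! ### The best of several clusterings -/

section Trials

variable {n : ℕ}

/-- The number of independent trials. -/
abbrev trials : ℕ := 20

/-- The number of sampled pairs per drawn vertex. -/
abbrev sampling : ℕ := 2048

/-- The number of tape entries that a trial reads: `k` candidates for pivots and `sampling * k`
pairs. -/
def trialLength (k : ℕ) : ℕ := k + 2 * (sampling * k)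

/-- The pivots that a trial finds. -/
noncomputable def trialPivots (G : SimpleGraph (Fin n)) (k : ℕ) (l : List (Fin n)) :
    List (Fin n) :=
  pivots G [] (l.take k)

/-- The number of errors that a trial finds in its sample. -/
noncomputable def trialCount (G : SimpleGraph (Fin n)) (k : ℕ) (l : List (Fin n)) : ℕ :=
  countPairs (Errs G (pivotClustering G (trialPivots G k l))) (l.drop k)

variable (G : SimpleGraph (Fin n))

theorem drawMean_trial (k : ℕ) (f : List (Fin n) → ℕ → ℝ) :
    drawMean (trialLength k) (fun l => f (trialPivots G k l) (trialCount G k l))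
      = drawMean k fun l => drawMean (2 * (sampling * k)) fun l' =>
        f (pivots G [] l) (countPairs (Errs G (pivotClustering G (pivots G [] l))) l') := by
  rw [trialLength, drawMean_append]
  refine drawMean_congr fun l hl => drawMean_congr fun l' _ => ?_
  rw [trialCount, trialPivots, List.take_left' hl, List.drop_left' hl]

theorem pairDensity_errs (cl : Fin n → ℕ) :
    pairDensity (Errs G cl) = 2 * (disagreements G cl : ℝ) / (n : ℝ) ^ 2 := by
  rw [pairDensity, two_mul_disagreements]

variable [NeZero n]

/-- The count below which a trial is trusted: `10 / 9` times the bound on the expected count. -/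
noncomputable def threshold (k : ℕ) : ℝ :=
  10 / 9 * ((sampling * k : ℕ) * ((6 * optCost G + (n : ℝ) ^ 2 / k) / (n : ℝ) ^ 2))

theorem drawMean_threshold_lt {k : ℕ} (hk : 0 < k) :
    drawMean (trialLength k) (fun l => ind (threshold G k < trialCount G k l)) ≤ 9 / 10 := by
  have hn : (0 : ℝ) < n := Nat.cast_pos.2 (NeZero.pos n)
  have hk0 : (0 : ℝ) < k := by exact_mod_cast hk
  set E : ℝ := (sampling * k : ℕ) * ((6 * optCost G + (n : ℝ) ^ 2 / k) / (n : ℝ) ^ 2) with hE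
  have hE0 : 0 < E := by
    have : (0 : ℝ) < (sampling * k : ℕ) := by exact_mod_cast (by positivity : 0 < sampling * k)
    positivity
  have h1 : drawMean (trialLength k) (fun l => (trialCount G k l : ℝ)) ≤ E := by
    rw [drawMean_trial G k (fun _ c => (c : ℝ))]
    simp only [drawMean_countPairs, pairDensity_errs, drawMean_const_mul,
      div_eq_inv_mul _ ((n : ℝ) ^ 2)]
    rw [hE, div_eq_inv_mul _ ((n : ℝ) ^ 2)]
    gcongr
    have := drawMean_disagreements_le G hk
    rwa [drawMean_const_mul] at this
  have h2 := drawMean_markov (trialLength k) (fun l : List (Fin n) => (trialCount G k l : ℝ))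
    (fun l => Nat.cast_nonneg _) (threshold G k)
  have h3 : threshold G k = 10 / 9 * E := rfl
  rw [h3] at h2 ⊢
  have h4 : E * (10 / 9 * drawMean (trialLength k)
      (fun l : List (Fin n) => ind (10 / 9 * E < trialCount G k l))) ≤ E * 1 := by linarith
  have := le_of_mul_le_mul_left h4 hE0
  linarith

/-- A trial is bad if it is trusted although its clustering is not good enough. -/
def BadTrial (ε : ℝ) (k : ℕ) (l : List (Fin n)) : Prop :=
  ¬ IsApproxClustering 4 ε G (pivotClustering G (trialPivots G k l)) ∧
    (trialCount G k l : ℝ) ≤ threshold G k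

theorem drawMean_badTrial_le {ε : ℝ} (hε : 0 < ε) {k : ℕ} (hk : 1 ≤ k * ε) :
    drawMean (trialLength k) (fun l => ind (BadTrial G ε k l)) ≤ 18 / sampling := by
  have hn : (0 : ℝ) < n := Nat.cast_pos.2 (NeZero.pos n)
  have hk0 : (0 : ℝ) < k := by
    by_contra! h
    nlinarith
  have hkn : 0 < k := by exact_mod_cast hk0
  refine (drawMean_trial G k (fun P c =>
    ind (¬ IsApproxClustering 4 ε G (pivotClustering G P) ∧ (c : ℝ) ≤ threshold G k))).trans_le ?_
  refine le_trans (drawMean_mono (g := fun _ => 18 / sampling) fun l _ => ?_)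
    (drawMean_const _ _).le
  by_cases hbad : IsApproxClustering 4 ε G (pivotClustering G (pivots G [] l))
  · simp only [hbad, not_true_eq_false, false_and, ind_false not_false, drawMean_const]
    norm_num
  · simp only [hbad, not_false_eq_true, true_and]
    rw [IsApproxClustering, not_le] at hbad
    set cl := pivotClustering G (pivots G [] l) with hcl
    have hdens : 2 * (4 * optCost G / (n : ℝ) ^ 2 + ε) ≤ pairDensity (Errs G cl) := by
      rw [pairDensity_errs, le_div_iff₀ (by positivity)]
      have : 2 * (4 * optCost G / (n : ℝ) ^ 2 + ε) * (n : ℝ) ^ 2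
          = 2 * (4 * optCost G + ε * (n : ℝ) ^ 2) := by field_simp
      linarith
    have hopt : 0 ≤ (optCost G : ℝ) / (n : ℝ) ^ 2 := by positivity
    have h1 := drawMean_countPairs_low (Errs G cl) (s := sampling * k) (τ := threshold G k)
      (p₀ := 2 * ε) (by positivity) (by positivity)
      (by have : 4 * optCost G / (n : ℝ) ^ 2 = 4 * (optCost G / (n : ℝ) ^ 2) := by ring
          linarith) ?_
    · refine h1.trans ?_
      push_cast
      rw [div_le_div_iff₀ (by positivity) (by norm_num)]
      norm_num
      linarith
    · have h2 : threshold G k = (sampling * k : ℕ)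
          * (20 / 3 * (optCost G / (n : ℝ) ^ 2) + 10 / 9 * (1 / k)) := by
        rw [threshold]
        field_simp
        ring
      have h3 : 1 / (k : ℝ) ≤ ε := by rw [div_le_iff₀ hk0]; linarith
      rw [h2, mul_left_comm]
      gcongr
      have : 4 * optCost G / (n : ℝ) ^ 2 = 4 * (optCost G / (n : ℝ) ^ 2) := by ring
      linarith

/-- The trial with the smallest count is good with probability at least `2 / 3`: otherwise either
no trial is trusted or some bad trial is. -/
theorem best_trial_good {ε : ℝ} (hε : 0 < ε) {k : ℕ} (hk : 1 ≤ k * ε) (best : (ℕ → Fin n) → ℕ)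
    (hbest : ∀ ω, best ω < trials)
    (hmin : ∀ ω, ∀ j < trials,
      trialCount G k (stretch ω (best ω * trialLength k) (trialLength k))
        ≤ trialCount G k (stretch ω (j * trialLength k) (trialLength k))) :
    2 / 3 ≤ (tapeLaw n).real {ω | IsApproxClustering 4 ε G
      (pivotClustering G (trialPivots G k
        (stretch ω (best ω * trialLength k) (trialLength k))))} := by
  have hk0 : 0 < k := by
    rcases Nat.eq_zero_or_pos k with rfl | h
    · norm_num at hk
    · exact h
  set T := trialLength k with hT
  let Q : List (Fin n) → Prop := fun l => threshold G k < trialCount G k l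
  let B : List (Fin n) → Prop := BadTrial G ε k
  let F : List (Fin n) → Prop := fun L =>
    ¬ (∀ j < trials, Q (window T j L)) ∧ ∀ j < trials, ¬ B (window T j L)
  have : IsProbabilityMeasure (tapeLaw n) := by unfold tapeLaw; infer_instance
  have h1 : 2 / 3 ≤ (tapeLaw n).real {ω | F (stretch ω 0 (trials * T))} := by
    rw [tapeLaw_prefix]
    have hF : ∀ L, 1 ≤ ind (F L) + (∏ j ∈ Finset.range trials, ind (Q (window T j L))
        + ∑ j ∈ Finset.range trials, ind (B (window T j L))) := by
      intro L
      have hp : 0 ≤ ∏ j ∈ Finset.range trials, ind (Q (window T j L)) :=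
        Finset.prod_nonneg fun _ _ => ind_nonneg _
      have hs : 0 ≤ ∑ j ∈ Finset.range trials, ind (B (window T j L)) :=
        Finset.sum_nonneg fun _ _ => ind_nonneg _
      by_cases hF : F L
      · rw [ind_true hF]
        linarith
      · rw [ind_false hF]
        rw [not_and_or, not_not, not_forall] at hF
        rcases hF with hF | ⟨j, hF⟩
        · rw [Finset.prod_congr rfl fun j hj => ind_true (hF j (Finset.mem_range.1 hj))]
          simp only [Finset.prod_const_one]
          linarith
        · rw [Classical.not_imp, not_not] at hF
          have := Finset.single_le_sum (f := fun j => ind (B (window T j L)))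
            (fun _ _ => ind_nonneg _) (Finset.mem_range.2 hF.1)
          simp only [ind_true hF.2] at this
          linarith
    have h2 := drawMean_mono (m := trials * T) fun L _ => hF L
    rw [drawMean_const, drawMean_add, drawMean_add,
      drawMean_prod_window T trials fun l => ind (Q l),
      drawMean_sum_window T trials fun l => ind (B l)] at h2
    have h3 : drawMean T (fun l => ind (Q l)) ^ trials ≤ (9 / 10) ^ trials :=
      pow_le_pow_left₀ (drawMean_nonneg fun l => ind_nonneg _) (drawMean_threshold_lt G hk0) _
    have h4 : drawMean T (fun l => ind (B l)) ≤ 18 / sampling := drawMean_badTrial_le G hε hk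
    norm_num at h2 h3 h4 ⊢
    linarith
  refine h1.trans (measureReal_mono ?_)
  rintro ω ⟨hω1, hω2⟩
  by_contra hbad
  push Not at hω1
  obtain ⟨j, hj, hQ⟩ := hω1
  have hω3 := hω2 _ (hbest ω)
  rw [window_stretch ω T hj, not_lt] at hQ
  rw [window_stretch ω T (hbest ω)] at hω3
  refine hω3 ⟨hbad, le_trans ?_ hQ⟩
  exact_mod_cast hmin ω j hj

end Trials

/-! ### Reasoning about runs of programs -/

section Programs

variable {n : ℕ} {G : SimpleGraph (Fin n)} {ω : ℕ → Fin n}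

/-- The program `P`, started in `s`, halts in a configuration with the property `R`. -/
def HaltsWith (G : SimpleGraph (Fin n)) (ω : ℕ → Fin n) (P : Cmd) (s : State)
    (R : State → Prop) : Prop :=
  ∃ s', Exec G ω P s s' ∧ R s'

theorem HaltsWith.mono {P : Cmd} {s : State} {R R' : State → Prop} (h : HaltsWith G ω P s R)
    (hR : ∀ s', R s' → R' s') : HaltsWith G ω P s R' :=
  let ⟨s', h1, h2⟩ := h
  ⟨s', h1, hR s' h2⟩

theorem haltsWith_skip {s : State} {R : State → Prop} (h : R s.tick) :
    HaltsWith G ω .skip s R := ⟨_, .skip s, h⟩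

theorem haltsWith_const {s : State} {R : State → Prop} {r a : ℕ} (h : R (s.set r a)) :
    HaltsWith G ω (.const r a) s R := ⟨_, .const r a s, h⟩

theorem haltsWith_copy {s : State} {R : State → Prop} {r x : ℕ} (h : R (s.set r (s.reg x))) :
    HaltsWith G ω (.copy r x) s R := ⟨_, .copy r x s, h⟩

theorem haltsWith_add {s : State} {R : State → Prop} {r x y : ℕ}
    (h : R (s.set r (s.reg x + s.reg y))) : HaltsWith G ω (.add r x y) s R := ⟨_, .add r x y s, h⟩

theorem haltsWith_sub {s : State} {R : State → Prop} {r x y : ℕ}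
    (h : R (s.set r (s.reg x - s.reg y))) : HaltsWith G ω (.sub r x y) s R := ⟨_, .sub r x y s, h⟩

theorem haltsWith_load {s : State} {R : State → Prop} {r x : ℕ}
    (h : R (s.set r (s.mem (s.reg x)))) : HaltsWith G ω (.load r x) s R := ⟨_, .load r x s, h⟩

theorem haltsWith_store {s : State} {R : State → Prop} {x y : ℕ}
    (h : R { s.tick with mem := Function.update s.mem (s.reg x) (s.reg y) }) :
    HaltsWith G ω (.store x y) s R := ⟨_, .store x y s, h⟩

theorem haltsWith_query {s : State} {R : State → Prop} {r x y : ℕ}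
    (h : R { s.set r (oracle G (s.reg x) (s.reg y)) with log := (s.reg x, s.reg y) :: s.log }) :
    HaltsWith G ω (.query r x y) s R := ⟨_, .query r x y s, h⟩

theorem haltsWith_rand {s : State} {R : State → Prop} {r : ℕ}
    (h : R { s.set r (ω s.drawn : ℕ) with drawn := s.drawn + 1 }) :
    HaltsWith G ω (.rand r) s R := ⟨_, .rand r s, h⟩

theorem haltsWith_seq {P Q : Cmd} {s : State} {R : State → Prop}
    (h : HaltsWith G ω P s fun s' => HaltsWith G ω Q s' R) : HaltsWith G ω (.seq P Q) s R :=
  let ⟨_, h1, s'', h2, h3⟩ := h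
  ⟨s'', .seq h1 h2, h3⟩

theorem haltsWith_iteLt {x y : ℕ} {P Q : Cmd} {s : State} {R : State → Prop}
    (h1 : s.reg x < s.reg y → HaltsWith G ω P s.tick R)
    (h2 : ¬ s.reg x < s.reg y → HaltsWith G ω Q s.tick R) :
    HaltsWith G ω (.iteLt x y P Q) s R := by
  by_cases h : s.reg x < s.reg y
  · obtain ⟨s', h3, h4⟩ := h1 h
    exact ⟨s', .iteLt_true h h3, h4⟩
  · obtain ⟨s', h3, h4⟩ := h2 h
    exact ⟨s', .iteLt_false h h3, h4⟩

/-- A loop with a predetermined number of iterations. -/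
theorem haltsWith_whileLt {x y : ℕ} {P : Cmd} {R : State → Prop} (I : ℕ → State → Prop) (N : ℕ)
    {s : State} (h0 : I 0 s)
    (hstep : ∀ i < N, ∀ s, I i s → s.reg x < s.reg y ∧ HaltsWith G ω P s.tick (I (i + 1)))
    (hend : ∀ s, I N s → ¬ s.reg x < s.reg y ∧ R s.tick) :
    HaltsWith G ω (.whileLt x y P) s R := by
  have key : ∀ j i s, i + j = N → I i s → HaltsWith G ω (.whileLt x y P) s R := by
    intro j
    induction j with
    | zero =>
      intro i s hi hI
      obtain rfl : i = N := by omega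
      exact ⟨_, .whileLt_false (hend s hI).1, (hend s hI).2⟩
    | succ j ih =>
      intro i s hi hI
      obtain ⟨h1, s1, h2, h3⟩ := hstep i (by omega) s hI
      obtain ⟨s2, h4, h5⟩ := ih (i + 1) s1 (by omega) h3
      exact ⟨s2, .whileLt_true h1 h2 h4, h5⟩
  exact key N 0 s (by omega) h0

theorem Exec.log_length_le {P : Cmd} {s s' : State} (h : Exec G ω P s s') :
    s'.log.length + s.time ≤ s'.time + s.log.length := by
  induction h with
  | seq _ _ ih1 ih2 => omega
  | iteLt_true _ _ ih => simp only [State.tick] at ih; omega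
  | iteLt_false _ _ ih => simp only [State.tick] at ih; omega
  | whileLt_true _ _ _ ih1 ih2 => simp only [State.tick] at ih1; omega
  | _ => simp [State.tick, State.set]; try omega

/-! ### The programs -/

open Classical in
/-- A truth value, as a register content. -/
noncomputable def bit (p : Prop) : ℕ := if p then 1 else 0

theorem bit_true {p : Prop} (h : p) : bit p = 1 := if_pos h

theorem bit_false {p : Prop} (h : ¬ p) : bit p = 0 := if_neg h

theorem oracle_eq_bit (x y : Fin n) : oracle G x y = bit (G.Adj x y) := by
  by_cases h : G.Adj x y
  · rw [bit_true h, oracle, if_pos ⟨x.2, y.2, h⟩]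
  · rw [bit_false h, oracle, if_neg fun ⟨_, _, h'⟩ => h h']

/-- Execute a sequence of commands given as a list. -/
def block : List Cmd → Cmd
  | [] => .skip
  | P :: l => .seq P (block l)

theorem haltsWith_block_cons {P : Cmd} {l : List Cmd} {s : State} {R : State → Prop}
    (h : HaltsWith G ω P s fun s' => HaltsWith G ω (block l) s' R) :
    HaltsWith G ω (block (P :: l)) s R := haltsWith_seq h

theorem haltsWith_block_nil {s : State} {R : State → Prop} (h : R s.tick) :
    HaltsWith G ω (block []) s R := haltsWith_skip h

/-- `equalCmd t x y`: register `t` tells whether the registers `x` and `y` agree. -/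
def equalCmd (t x y : ℕ) : Cmd :=
  .iteLt x y (.const t 0) (.iteLt y x (.const t 0) (.const t 1))

theorem haltsWith_equalCmd {t x y : ℕ} {s : State} {R : State → Prop}
    (h : ∀ τ ≤ s.time + 3, R { s with
      reg := Function.update s.reg t (bit (s.reg x = s.reg y)), time := τ }) :
    HaltsWith G ω (equalCmd t x y) s R := by
  refine haltsWith_iteLt (fun h1 => haltsWith_const ?_) fun h1 => haltsWith_iteLt
    (fun h2 => haltsWith_const ?_) fun h2 => haltsWith_const ?_
  · have := h (s.time + 2) (by omega)
    rwa [bit_false h1.ne] at this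
  · have := h (s.time + 3) (by omega)
    rwa [bit_false (p := s.reg x = s.reg y) (Nat.ne_of_gt h2)] at this
  · have := h (s.time + 3) (by omega)
    rwa [bit_true (p := s.reg x = s.reg y) (le_antisymm (not_lt.1 h2) (not_lt.1 h1))] at this

/-- `nearCmd t x y`: register `t` tells whether the vertices in the registers `x` and `y` are
near. -/
def nearCmd (t x y : ℕ) : Cmd :=
  .seq (.query t x y) (.iteLt x y .skip (.iteLt y x .skip (.const t 1)))

theorem haltsWith_nearCmd {t x y : ℕ} {s : State} {R : State → Prop} (hx : x ≠ t) (hy : y ≠ t)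
    {u v : Fin n} (hu : s.reg x = u) (hv : s.reg y = v)
    (h : ∀ τ ≤ s.time + 4, R { s with
      reg := Function.update s.reg t (bit (Near G u v)), time := τ,
      log := ((u : ℕ), (v : ℕ)) :: s.log }) :
    HaltsWith G ω (nearCmd t x y) s R := by
  refine haltsWith_seq (haltsWith_query ?_)
  rw [hu, hv, oracle_eq_bit]
  have hne : u ≠ v → bit (G.Adj u v) = bit (Near G u v) := by
    intro h
    rw [Near, or_iff_right h]
  refine haltsWith_iteLt (fun h1 => haltsWith_skip ?_) fun h1 => haltsWith_iteLt
    (fun h2 => haltsWith_skip ?_) fun h2 => haltsWith_const ?_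
  · simp only [State.set, Function.update_of_ne hx, Function.update_of_ne hy, hu, hv] at h1
    rw [hne (by rintro rfl; exact lt_irrefl _ h1)]
    exact h (s.time + 3) (by omega)
  · simp only [State.tick, State.set, Function.update_of_ne hx, Function.update_of_ne hy, hu,
      hv] at h2
    rw [hne (by rintro rfl; exact lt_irrefl _ h2)]
    exact h (s.time + 4) (by omega)
  · simp only [State.tick, State.set, Function.update_of_ne hx, Function.update_of_ne hy, hu,
      hv] at h1 h2
    have e : u = v := by ext; omega
    have := h (s.time + 4) (by omega)
    rw [bit_true (p := Near G u v) (Or.inl e)] at this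
    simpa [State.tick, State.set] using this

/-- The label of the vertex in register `6`.  The candidates for pivots are stored between the
addresses in the registers `4` and `5`, each followed by a bit that tells whether it is a pivot.
They are scanned from the last to the first, each of them is compared with the vertex, and register
`7` receives every pivot near the vertex, so the first one remains.  Register `3` holds `1`. -/
def labelCmd : Cmd :=
  block [.copy 8 5, .copy 7 6, .whileLt 4 8 (block [.sub 8 8 3, .load 10 8, .sub 8 8 3, .load 9 8,
    nearCmd 11 6 9, .add 11 11 10, .iteLt 3 11 (.copy 7 9) .skip])]

/-- The candidates `Q i` with `a ≤ i < a + m` that are pivots according to `fl`. -/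
noncomputable def selected (Q : ℕ → Fin n) (fl : ℕ → Prop) (a m : ℕ) : List (Fin n) :=
  haveI := Classical.decPred fl
  ((List.range' a m).filter fl).map Q

theorem selected_succ_left (Q : ℕ → Fin n) (fl : ℕ → Prop) (a m : ℕ) (x : Fin n) :
    pivotLabel G (selected Q fl a (m + 1)) x =
      haveI := Classical.propDecidable
      if fl a ∧ Near G x (Q a) then Q a else pivotLabel G (selected Q fl (a + 1) m) x := by
  rw [selected, List.range'_succ, List.filter_cons]
  by_cases h : fl a
  · by_cases hx : Near G x (Q a) <;> simp [h, hx, pivotLabel, selected]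
  · simp [h, selected]

theorem haltsWith_labelCmd {s : State} {R : State → Prop} {base m : ℕ} {x : Fin n}
    {Q : ℕ → Fin n} {fl : ℕ → Prop} (h3 : s.reg 3 = 1) (h4 : s.reg 4 = base)
    (h5 : s.reg 5 = base + 2 * m) (h6 : s.reg 6 = x)
    (hmem : ∀ i < m, s.mem (base + 2 * i) = Q i ∧ s.mem (base + 2 * i + 1) = bit (fl i))
    (h : ∀ s' : State, s'.reg 7 = pivotLabel G (selected Q fl 0 m) x →
      (∀ r, r < 7 ∨ 11 < r → s'.reg r = s.reg r) → s'.mem = s.mem → s'.drawn = s.drawn →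
      s'.log = ((List.range m).map fun i => ((x : ℕ), (Q i : ℕ))) ++ s.log →
      s'.time ≤ s.time + (14 * m + 4) → R s') :
    HaltsWith G ω labelCmd s R := by
  refine haltsWith_block_cons (haltsWith_copy (haltsWith_block_cons (haltsWith_copy
    (haltsWith_block_cons ?_))))
  refine haltsWith_whileLt (fun t s' => ∃ i, i + t = m ∧ s'.reg 8 = base + 2 * i ∧
      s'.reg 7 = pivotLabel G (selected Q fl i t) x ∧
      (∀ r, r < 7 ∨ 11 < r → s'.reg r = s.reg r) ∧ s'.mem = s.mem ∧ s'.drawn = s.drawn ∧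
      s'.log = ((List.range' i t).map fun i => ((x : ℕ), (Q i : ℕ))) ++ s.log ∧
      s'.time ≤ s.time + (14 * t + 2)) m ?_ ?_ ?_
  · refine ⟨m, rfl, ?_, ?_, ?_, rfl, rfl, by simp [State.set], by simp [State.set]⟩
    · simp [State.set, h5]
    · simp [State.set, h6, selected, pivotLabel]
    · intro r hr
      simp [State.set, show r ≠ 8 by omega, show r ≠ 7 by omega]
  · rintro t ht s' ⟨i, hi, e8, e7, er, em, ed, el, et⟩
    obtain ⟨i, rfl⟩ : ∃ i', i = i' + 1 := ⟨i - 1, by omega⟩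
    have e3 := (er 3 (by omega)).trans h3
    have e4 := (er 4 (by omega)).trans h4
    have e6 := (er 6 (by omega)).trans h6
    refine ⟨by omega, ?_⟩
    refine haltsWith_block_cons (haltsWith_sub (haltsWith_block_cons (haltsWith_load
      (haltsWith_block_cons (haltsWith_sub (haltsWith_block_cons (haltsWith_load
      (haltsWith_block_cons ?_))))))))
    have a1 : base + 2 * (i + 1) - 1 = base + 2 * i + 1 := by omega
    have a2 : base + 2 * i + 1 - 1 = base + 2 * i := by omega
    obtain ⟨m1, m2⟩ := hmem i (by omega)
    simp [State.set, State.tick, e8, e3, a1, a2, em, m1, m2]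
    refine haltsWith_nearCmd (u := x) (v := Q i) (by decide) (by decide) (by simp [e6])
      (by simp) fun τ hτ => ?_
    refine haltsWith_block_cons (haltsWith_add (haltsWith_block_cons ?_))
    simp [State.set] at hτ ⊢
    -- register `11` holds `2` exactly if `Q i` is a pivot near `x`
    have hbit : bit (Near G x (Q i)) + bit (fl i) = 2 ∧ (fl i ∧ Near G x (Q i)) ∨
        bit (Near G x (Q i)) + bit (fl i) ≤ 1 ∧ ¬ (fl i ∧ Near G x (Q i)) := by
      by_cases c1 : Near G x (Q i) <;> by_cases c2 : fl i <;> simp [bit, c1, c2]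
    have el' : (((x : ℕ), (Q i : ℕ)) :: s'.log)
        = ((List.range' i (t + 1)).map fun i => ((x : ℕ), (Q i : ℕ))) ++ s.log := by
      rw [el, List.range'_succ]
      rfl
    refine haltsWith_iteLt (fun c => haltsWith_copy (haltsWith_block_nil ?_))
      fun c => haltsWith_skip (haltsWith_block_nil ?_)
    · simp [e3] at c
      have c' : fl i ∧ Near G x (Q i) := by
        rcases hbit with h | h
        · exact h.2
        · omega
      refine ⟨i, by omega, ?_, ?_, ?_, rfl, ed, el', ?_⟩
      · simp [State.tick, State.set]
      · simp [State.tick, State.set, selected_succ_left, c']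
      · intro r hr
        simp [State.tick, State.set, show r ≠ 8 by omega, show r ≠ 7 by omega,
          show r ≠ 9 by omega, show r ≠ 10 by omega, show r ≠ 11 by omega, er r hr]
      · simp only [State.tick, State.set]; omega
    · simp [e3] at c
      have c' : ¬ (fl i ∧ Near G x (Q i)) := by
        rcases hbit with h | h
        · omega
        · exact h.2
      refine ⟨i, by omega, ?_, ?_, ?_, rfl, ed, el', ?_⟩
      · simp [State.tick]
      · simp [State.tick, selected_succ_left, c', e7]
      · intro r hr
        simp [State.tick, show r ≠ 8 by omega,
          show r ≠ 9 by omega, show r ≠ 10 by omega, show r ≠ 11 by omega, er r hr]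
      · simp only [State.tick]; omega
  · rintro s' ⟨i, hi, e8, e7, er, em, ed, el, et⟩
    obtain rfl : i = 0 := by omega
    refine ⟨?_, ?_⟩
    · rw [er 4 (by omega), h4, e8]; omega
    · refine haltsWith_skip (h _ ?_ er em ed ?_ ?_)
      · exact e7
      · simpa [State.tick, List.range_eq_range'] using el
      · simp only [State.tick]; omega

/-! ### Drawing pivots and sampling pairs -/

/-- The vertex in position `d + i` of the tape becomes a pivot when the pivots are drawn from
position `d` on. -/
def IsPivotAt (G : SimpleGraph (Fin n)) (ω : ℕ → Fin n) (d i : ℕ) : Prop :=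
  pivotLabel G (pivots G [] (stretch ω d i)) (ω (d + i)) = ω (d + i)

theorem selected_isPivotAt (d m : ℕ) :
    selected (fun i => ω (d + i)) (IsPivotAt G ω d) 0 m = pivots G [] (stretch ω d m) := by
  classical
  induction m with
  | zero => rfl
  | succ m ih =>
    have h1 : selected (fun i => ω (d + i)) (IsPivotAt G ω d) 0 (m + 1)
        = selected (fun i => ω (d + i)) (IsPivotAt G ω d) 0 m
          ++ if IsPivotAt G ω d m then [ω (d + m)] else [] := by
      unfold selected
      rw [List.range'_concat, List.filter_append, List.map_append]
      by_cases h : IsPivotAt G ω d m <;> simp [h]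
    have h2 : stretch ω d (m + 1) = stretch ω d m ++ [ω (d + m)] := by
      rw [stretch_add]; rfl
    have h3 : pivots G [] (stretch ω d m ++ [ω (d + m)])
        = addPivot G (pivots G [] (stretch ω d m)) (ω (d + m)) := by
      rw [pivots, List.foldl_append]; rfl
    rw [h1, ih, h2, h3, addPivot]
    by_cases h : IsPivotAt G ω d m
    · rw [if_pos h, if_pos (show pivotLabel G _ _ = _ from h)]
    · rw [if_neg h, if_neg (show ¬ pivotLabel G _ _ = _ from h), List.append_nil]

/-- The memory from address `base` on describes the pivots drawn from position `d` on. -/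
def StoresPivots (G : SimpleGraph (Fin n)) (ω : ℕ → Fin n) (d m base : ℕ) (mem : ℕ → ℕ) : Prop :=
  ∀ i < m, mem (base + 2 * i) = ω (d + i) ∧ mem (base + 2 * i + 1) = bit (IsPivotAt G ω d i)

/-- The queries of `labelCmd`. -/
def labelLog (ω : ℕ → Fin n) (d m : ℕ) (x : Fin n) : List (ℕ × ℕ) :=
  (List.range m).map fun i => ((x : ℕ), (ω (d + i) : ℕ))

theorem haltsWith_labelCmd_of_stores {s : State} {R : State → Prop} {base d m : ℕ} {x : Fin n}
    (h3 : s.reg 3 = 1) (h4 : s.reg 4 = base) (h5 : s.reg 5 = base + 2 * m) (h6 : s.reg 6 = x)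
    (hmem : StoresPivots G ω d m base s.mem)
    (h : ∀ s' : State, s'.reg 7 = pivotLabel G (pivots G [] (stretch ω d m)) x →
      (∀ r, r < 7 ∨ 11 < r → s'.reg r = s.reg r) → s'.mem = s.mem → s'.drawn = s.drawn →
      s'.log = labelLog ω d m x ++ s.log → s'.time ≤ s.time + (14 * m + 4) → R s') :
    HaltsWith G ω labelCmd s R :=
  haltsWith_labelCmd h3 h4 h5 h6 hmem (by rw [selected_isPivotAt]; exact h)

/-- Draw a vertex and store it, together with the bit that tells whether it is a pivot.  Register
`5` holds the first free address. -/
def drawCmd : Cmd :=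
  block [.rand 6, labelCmd, .store 5 6, .add 5 5 3, equalCmd 20 6 7, .store 5 20, .add 5 5 3]

/-- The queries made while `m` candidates for pivots are drawn. -/
def drawLog (ω : ℕ → Fin n) (d : ℕ) : ℕ → List (ℕ × ℕ) → List (ℕ × ℕ)
  | 0, acc => acc
  | m + 1, acc => labelLog ω d m (ω (d + m)) ++ drawLog ω d m acc

theorem haltsWith_drawLoop {s : State} {R : State → Prop} {base d k : ℕ}
    (h3 : s.reg 3 = 1) (h4 : s.reg 4 = base) (h5 : s.reg 5 = base) (h15 : s.reg 15 = base + 2 * k)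
    (hd : s.drawn = d)
    (h : ∀ s' : State, s'.reg 5 = base + 2 * k → StoresPivots G ω d k base s'.mem →
      (∀ a < base, s'.mem a = s.mem a) → s'.drawn = d + k → s'.log = drawLog ω d k s.log →
      (∀ r, r < 5 ∨ (11 < r ∧ r ≠ 20) → s'.reg r = s.reg r) →
      s'.time ≤ s.time + (k * (14 * k + 16) + 1) → R s') :
    HaltsWith G ω (.whileLt 5 15 drawCmd) s R := by
  refine haltsWith_whileLt (fun t s' => s'.reg 5 = base + 2 * t ∧
    StoresPivots G ω d t base s'.mem ∧ (∀ a < base, s'.mem a = s.mem a) ∧ s'.drawn = d + t ∧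
    s'.log = drawLog ω d t s.log ∧ (∀ r, r < 5 ∨ (11 < r ∧ r ≠ 20) → s'.reg r = s.reg r) ∧
    s'.time ≤ s.time + t * (14 * k + 16)) k ?_ ?_ ?_
  · exact ⟨h5, fun i hi => absurd hi (Nat.not_lt_zero i), fun _ _ => rfl, hd, rfl, fun _ _ => rfl,
      by omega⟩
  · rintro t ht s₁ ⟨e5, em, eb, ed, el, er, et⟩
    have e3 := (er 3 (by omega)).trans h3
    have e4 := (er 4 (by omega)).trans h4
    have e15 := (er 15 (by omega)).trans h15
    refine ⟨by omega, ?_⟩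
    refine haltsWith_block_cons (haltsWith_rand (haltsWith_block_cons ?_))
    refine haltsWith_labelCmd_of_stores (base := base) (d := d) (m := t) (x := ω (d + t))
      (by simp [State.set, State.tick, e3]) (by simp [State.set, State.tick, e4])
      (by simp [State.set, State.tick, e5]) (by simp [State.set, State.tick, ed])
      (by simpa [State.set, State.tick] using em) ?_
    intro s₂ f7 fr fm fd fl ft
    have f3 : s₂.reg 3 = 1 := by rw [fr 3 (by omega)]; simp [State.set, State.tick, e3]
    have f5 : s₂.reg 5 = base + 2 * t := by
      rw [fr 5 (by omega)]; simp [State.set, State.tick, e5]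
    have f6 : s₂.reg 6 = ω (d + t) := by rw [fr 6 (by omega)]; simp [State.set, State.tick, ed]
    have fr' : ∀ r, r < 6 ∨ 11 < r → s₂.reg r = s₁.reg r := fun r hr => by
      rw [fr r (by omega)]; simp [State.set, State.tick, show r ≠ 6 by omega]
    refine haltsWith_block_cons (haltsWith_store (haltsWith_block_cons (haltsWith_add
      (haltsWith_block_cons (haltsWith_equalCmd fun τ hτ => haltsWith_block_cons (haltsWith_store
      (haltsWith_block_cons (haltsWith_add (haltsWith_block_nil ?_)))))))))
    simp only [State.set, State.tick] at hτ ft fm fd fl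
    simp [State.set, State.tick, f3, f5, f6, f7, Fin.val_inj]
    refine ⟨by omega, ?_, ?_, by omega, ?_, ?_, ?_⟩
    · intro i hi
      rw [fm]
      rcases Nat.lt_succ_iff_lt_or_eq.1 hi with hi | rfl
      · have := em i hi
        simpa [Function.update_apply, show base + 2 * i ≠ base + 2 * t by omega,
          show base + 2 * i ≠ base + 2 * t + 1 by omega,
          show base + 2 * i + 1 ≠ base + 2 * t by omega,
          show i ≠ t by omega] using this
      · simp [IsPivotAt, eq_comm]
    · intro a ha
      rw [fm]
      simp [show a ≠ base + 2 * t by omega,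
        show a ≠ base + 2 * t + 1 by omega, eb a ha]
    · rw [fl, el]; rfl
    · intro r hr
      simp [show r ≠ 5 by omega, show r ≠ 20 by omega, fr' r (by omega), er r hr]
    · have : (t + 1) * (14 * k + 16) = t * (14 * k + 16) + (14 * k + 16) := by ring
      omega
  · rintro s₁ ⟨e5, em, eb, ed, el, er, et⟩
    refine ⟨?_, h _ e5 em eb ed el er ?_⟩
    · rw [e5, er 15 (by omega), h15]; omega
    · simp only [State.tick]; omega

/-- Increase register `14` if register `20` does not hold the bit `1`. -/
def countCmd : Cmd := .iteLt 20 3 (.add 14 14 3) .skip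

theorem haltsWith_countCmd {s : State} {R : State → Prop} {p : Prop} (h3 : s.reg 3 = 1)
    (h20 : s.reg 20 = bit p)
    (h : ∀ τ ≤ s.time + 2, R { s with
      reg := Function.update s.reg 14 (s.reg 14 + bit (¬ p)), time := τ }) :
    HaltsWith G ω countCmd s R := by
  have := h (s.time + 2) le_rfl
  refine haltsWith_iteLt (fun c => haltsWith_add ?_) fun c => haltsWith_skip ?_ <;>
    rw [h3, h20] at c <;> by_cases hp : p
  · rw [bit_true hp] at c; omega
  · rw [bit_true (p := ¬ p) hp, ← h3] at this
    exact this
  · rw [bit_false (p := ¬ p) (not_not.2 hp), add_zero, Function.update_eq_self] at this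
    exact this
  · rw [bit_false hp] at c; omega

/-- Draw two vertices and count an error of the clustering at this pair in register `14`.  The
first vertex and its label are kept in the registers `17` and `18`, and register `16` holds the
number of pairs that are still to be drawn. -/
def sampleCmd : Cmd :=
  block [.rand 6, labelCmd, .copy 17 6, .copy 18 7, .rand 6, labelCmd, nearCmd 11 17 6,
    equalCmd 20 18 7, equalCmd 20 11 20, countCmd, .sub 16 16 3]

/-- The queries made while `t` pairs are sampled from position `e` on. -/
def sampleLog (ω : ℕ → Fin n) (d m e : ℕ) : ℕ → List (ℕ × ℕ) → List (ℕ × ℕ)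
  | 0, acc => acc
  | t + 1, acc => ((ω (e + 2 * t) : ℕ), (ω (e + 2 * t + 1) : ℕ)) ::
      (labelLog ω d m (ω (e + 2 * t + 1)) ++
        (labelLog ω d m (ω (e + 2 * t)) ++ sampleLog ω d m e t acc))

theorem countPairs_append_pair (g : Fin n → Fin n → Prop) (x y : Fin n) (t : ℕ) :
    ∀ l : List (Fin n), l.length = 2 * t →
      countPairs g (l ++ [x, y]) = countPairs g l + bit (g x y) := by
  induction t with
  | zero =>
    intro l hl
    obtain rfl : l = [] := List.length_eq_zero_iff.1 (by omega)
    simp [countPairs, bit]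
  | succ t ih =>
    rintro (_ | ⟨a, _ | ⟨b, l⟩⟩) hl
    · simp at hl
    · simp at hl; omega
    · simp only [List.cons_append, countPairs]
      rw [ih l (by simp at hl; omega)]
      omega

theorem countPairs_stretch_succ (g : Fin n → Fin n → Prop) (e t : ℕ) :
    countPairs g (stretch ω e (2 * (t + 1)))
      = countPairs g (stretch ω e (2 * t)) + bit (g (ω (e + 2 * t)) (ω (e + 2 * t + 1))) := by
  have : stretch ω e (2 * (t + 1))
      = stretch ω e (2 * t) ++ [ω (e + 2 * t), ω (e + 2 * t + 1)] := by
    rw [Nat.mul_succ, stretch_add]; rfl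
  rw [this, countPairs_append_pair g _ _ t _ (by simp)]

theorem haltsWith_sampleLoop {s : State} {R : State → Prop} {base d m e N : ℕ}
    (h3 : s.reg 3 = 1) (h4 : s.reg 4 = base) (h5 : s.reg 5 = base + 2 * m) (h14 : s.reg 14 = 0)
    (h16 : s.reg 16 = N) (h21 : s.reg 21 = 0) (hd : s.drawn = e)
    (hmem : StoresPivots G ω d m base s.mem)
    (h : ∀ s' : State, s'.reg 14 = countPairs
        (Errs G (pivotClustering G (pivots G [] (stretch ω d m)))) (stretch ω e (2 * N)) →
      s'.mem = s.mem → s'.drawn = e + 2 * N → s'.log = sampleLog ω d m e N s.log →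
      (∀ r, r < 6 ∨ r = 12 ∨ r = 13 ∨ r = 15 ∨ r = 21 → s'.reg r = s.reg r) →
      s'.time ≤ s.time + (N * (28 * m + 28) + 1) → R s') :
    HaltsWith G ω (.whileLt 21 16 sampleCmd) s R := by
  set P := pivots G [] (stretch ω d m) with hP
  refine haltsWith_whileLt (fun t s' => s'.reg 16 + t = N ∧
    s'.reg 14 = countPairs (Errs G (pivotClustering G P)) (stretch ω e (2 * t)) ∧
    s'.mem = s.mem ∧ s'.drawn = e + 2 * t ∧ s'.log = sampleLog ω d m e t s.log ∧
    (∀ r, r < 6 ∨ r = 12 ∨ r = 13 ∨ r = 15 ∨ r = 21 → s'.reg r = s.reg r) ∧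
    s'.time ≤ s.time + t * (28 * m + 28)) N ?_ ?_ ?_
  · exact ⟨h16, h14, rfl, hd, rfl, fun _ _ => rfl, by omega⟩
  · rintro t ht s₁ ⟨e16, e14, em, ed, el, er, et⟩
    have e3 := (er 3 (by omega)).trans h3
    have e4 := (er 4 (by omega)).trans h4
    have e5 := (er 5 (by omega)).trans h5
    have e21 := (er 21 (by omega)).trans h21
    refine ⟨by omega, ?_⟩
    refine haltsWith_block_cons (haltsWith_rand (haltsWith_block_cons ?_))
    refine haltsWith_labelCmd_of_stores (base := base) (d := d) (m := m) (x := ω (e + 2 * t))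
      (by simp [State.set, State.tick, e3]) (by simp [State.set, State.tick, e4])
      (by simp [State.set, State.tick, e5]) (by simp [State.set, State.tick, ed])
      (by simpa [State.set, State.tick, em] using hmem) ?_
    intro s₂ f7 fr fm fd fl ft
    simp only [State.set, State.tick] at fm fd fl ft
    have f6 : s₂.reg 6 = ω (e + 2 * t) := by rw [fr 6 (by omega)]; simp [State.set, State.tick, ed]
    have fr' : ∀ r, r < 6 ∨ 11 < r → s₂.reg r = s₁.reg r := fun r hr => by
      rw [fr r (by omega)]; simp [State.set, State.tick, show r ≠ 6 by omega]
    clear fr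
    refine haltsWith_block_cons (haltsWith_copy (haltsWith_block_cons (haltsWith_copy
      (haltsWith_block_cons (haltsWith_rand (haltsWith_block_cons ?_))))))
    refine haltsWith_labelCmd_of_stores (base := base) (d := d) (m := m) (x := ω (e + 2 * t + 1))
      (by simp [State.set, fr', e3]) (by simp [State.set, fr', e4])
      (by simp [State.set, fr', e5]) (by simp [State.set, fd, ed])
      (by simpa [State.set, fm, em] using hmem) ?_
    intro s₃ g7 gr gm gd gl gt
    simp only [State.set] at gm gd gl gt
    have g17 : s₃.reg 17 = ω (e + 2 * t) := by rw [gr 17 (by omega)]; simp [State.set, f6]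
    have g18 : s₃.reg 18 = pivotLabel G P (ω (e + 2 * t)) := by
      rw [gr 18 (by omega)]; simp [State.set, f7, hP]
    have g6 : s₃.reg 6 = ω (e + 2 * t + 1) := by rw [gr 6 (by omega)]; simp [State.set, fd, ed]
    have gr' : ∀ r, r < 6 ∨ (11 < r ∧ r ≠ 17 ∧ r ≠ 18) → s₃.reg r = s₁.reg r := fun r hr => by
      rw [gr r (by omega)]
      simp [State.set, show r ≠ 6 by omega, show r ≠ 17 by omega, show r ≠ 18 by omega,
        fr' r (by omega)]
    clear gr
    have herr : bit (Errs G (pivotClustering G P) (ω (e + 2 * t)) (ω (e + 2 * t + 1)))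
        = bit (¬ (bit (Near G (ω (e + 2 * t)) (ω (e + 2 * t + 1)))
          = bit ((pivotLabel G P (ω (e + 2 * t)) : ℕ) = pivotLabel G P (ω (e + 2 * t + 1))))) := by
      unfold Errs pivotClustering
      by_cases c1 : Near G (ω (e + 2 * t)) (ω (e + 2 * t + 1)) <;>
        by_cases c2 : (pivotLabel G P (ω (e + 2 * t)) : ℕ) = pivotLabel G P (ω (e + 2 * t + 1)) <;>
        simp [bit, c1, c2]
    refine haltsWith_block_cons (haltsWith_nearCmd (u := ω (e + 2 * t)) (v := ω (e + 2 * t + 1))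
      (by decide) (by decide) g17 g6 fun τ₁ hτ₁ => haltsWith_block_cons (haltsWith_equalCmd
      fun τ₂ hτ₂ => haltsWith_block_cons (haltsWith_equalCmd fun τ₃ hτ₃ =>
      haltsWith_block_cons ?_)))
    simp [g18, g7, ← hP] at hτ₂ hτ₃ ⊢
    refine haltsWith_countCmd (p := bit (Near G (ω (e + 2 * t)) (ω (e + 2 * t + 1)))
      = bit ((pivotLabel G P (ω (e + 2 * t)) : ℕ) = pivotLabel G P (ω (e + 2 * t + 1))))
      (by simp [gr', e3]) (by simp) fun τ₄ hτ₄ =>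
      haltsWith_block_cons (haltsWith_sub (haltsWith_block_nil ?_))
    rw [← herr]
    simp [State.set, State.tick, gr', e3] at hτ₄ ⊢
    refine ⟨by omega, ?_, ?_, by omega, ?_, ?_, ?_⟩
    · rw [countPairs_stretch_succ, e14]
    · rw [gm, fm, em]
    · rw [gl, fl, el]; rfl
    · intro r hr
      simp [show r ≠ 16 by omega, show r ≠ 14 by omega, show r ≠ 20 by omega,
        show r ≠ 11 by omega, gr' r (by omega), er r hr]
    · have : (t + 1) * (28 * m + 28) = t * (28 * m + 28) + (28 * m + 28) := by ring
      omega
  · rintro s₁ ⟨e16, e14, em, ed, el, er, et⟩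
    refine ⟨?_, h _ e14 em ed el er ?_⟩
    · rw [er 21 (by omega), h21]; omega
    · simp only [State.tick]; omega

/-! ### Trials, preprocessing and labels -/

/-- Multiply register `r` by `2 ^ t`. -/
def scaleCmd (r t : ℕ) : Cmd := block (List.replicate t (.add r r r))

theorem haltsWith_scaleCmd {r t : ℕ} {s : State} {R : State → Prop}
    (h : R { s with reg := Function.update s.reg r (2 ^ t * s.reg r), time := s.time + t + 1 }) :
    HaltsWith G ω (scaleCmd r t) s R := by
  induction t generalizing s with
  | zero =>
    refine haltsWith_block_nil ?_
    rw [pow_zero, one_mul, Function.update_eq_self] at h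
    exact h
  | succ t ih =>
    refine haltsWith_block_cons (haltsWith_add (ih ?_))
    simp only [State.set, Function.update_self, Function.update_idem]
    have e1 : 2 ^ t * (s.reg r + s.reg r) = 2 ^ (t + 1) * s.reg r := by ring
    rw [e1, show s.time + 1 + t + 1 = s.time + (t + 1) + 1 by omega]
    exact h

/-- One trial, with its data stored from the address in register `4` on.  The smallest count so far
is in register `13`, and the address of the data of the trial that achieved it in register `12`.
The last conditional is padded so that its branches take equally long. -/
def trialCmd : Cmd :=
  block [.copy 5 4, .add 15 4 1, .add 15 15 1, .whileLt 5 15 drawCmd, .const 14 0, .copy 16 1,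
    scaleCmd 16 11, .whileLt 21 16 sampleCmd,
    .iteLt 14 13 (.seq (.copy 13 14) (.copy 12 4)) (.seq .skip .skip), .copy 4 15]

/-- The queries of a trial. -/
def trialLog (ω : ℕ → Fin n) (k d : ℕ) (acc : List (ℕ × ℕ)) : List (ℕ × ℕ) :=
  sampleLog ω d k (d + k) (sampling * k) (drawLog ω d k acc)

/-- A bound on the running time of a trial. -/
def trialTime (k : ℕ) : ℕ := k * (14 * k + 16) + sampling * k * (28 * k + 28) + 25

theorem haltsWith_trialCmd {s : State} {R : State → Prop} {base d k : ℕ}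
    (h1 : s.reg 1 = k) (h3 : s.reg 3 = 1) (h4 : s.reg 4 = base) (h21 : s.reg 21 = 0)
    (hd : s.drawn = d)
    (h : ∀ s' : State, s'.reg 4 = base + 2 * k → StoresPivots G ω d k base s'.mem →
      (∀ a < base, s'.mem a = s.mem a) → s'.drawn = d + trialLength k →
      s'.log = trialLog ω k d s.log → (∀ r, r < 4 ∨ r = 21 → s'.reg r = s.reg r) →
      (s'.reg 12, s'.reg 13) =
        (if trialCount G k (stretch ω d (trialLength k)) < s.reg 13
          then (base, trialCount G k (stretch ω d (trialLength k)))
          else (s.reg 12, s.reg 13)) →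
      s'.time ≤ s.time + trialTime k → R s') :
    HaltsWith G ω trialCmd s R := by
  refine haltsWith_block_cons (haltsWith_copy (haltsWith_block_cons (haltsWith_add
    (haltsWith_block_cons (haltsWith_add (haltsWith_block_cons ?_))))))
  simp [State.set, h1, h4]
  refine haltsWith_drawLoop (base := base) (d := d) (k := k) (by simp [h3]) (by simp [h4])
    (by simp) (by simp; omega) hd ?_
  intro s₁ e5 em eb ed el er et
  simp only at eb el et
  have er' : ∀ r, r < 5 ∨ r = 12 ∨ r = 13 ∨ r = 21 → s₁.reg r = s.reg r := fun r hr => by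
    rw [er r (by omega)]; simp [show r ≠ 5 by omega, show r ≠ 15 by omega]
  have e15 : s₁.reg 15 = base + 2 * k := by rw [er 15 (by omega)]; simp; omega
  clear er
  refine haltsWith_block_cons (haltsWith_const (haltsWith_block_cons (haltsWith_copy
    (haltsWith_block_cons (haltsWith_scaleCmd (haltsWith_block_cons ?_))))))
  simp [State.set, er', h1]
  refine haltsWith_sampleLoop (base := base) (d := d) (m := k) (e := d + k) (N := sampling * k)
    (by simp [er', h3]) (by simp [er', h4]) (by simp [e5]) (by simp) (by simp)
    (by simp [er', h21]) ed em ?_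
  intro s₂ f14 fm fd fl fr ft
  simp only at fm fl ft
  have f14' : s₂.reg 14 = trialCount G k (stretch ω d (trialLength k)) := by
    rw [f14, trialCount, trialPivots, trialLength, stretch_add, List.take_left' (by simp),
      List.drop_left' (by simp)]
  have fr' : ∀ r, r < 5 ∨ r = 12 ∨ r = 13 ∨ r = 21 → s₂.reg r = s.reg r := fun r hr => by
    rw [fr r (by omega)]
    simp [show r ≠ 14 by omega, show r ≠ 16 by omega, er' r hr]
  have f15 : s₂.reg 15 = base + 2 * k := by rw [fr 15 (by omega)]; simp [e15]
  clear fr f14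
  have htime : s₂.time + 5 ≤ s.time + trialTime k := by
    rw [trialTime]; omega
  refine haltsWith_block_cons (haltsWith_iteLt
    (fun c => haltsWith_seq (haltsWith_copy (haltsWith_copy (haltsWith_block_cons (haltsWith_copy
      (haltsWith_block_nil (h _ ?_ ?_ ?_ ?_ ?_ ?_ ?_ ?_)))))))
    fun c => haltsWith_seq (haltsWith_skip (haltsWith_skip (haltsWith_block_cons (haltsWith_copy
      (haltsWith_block_nil (h _ ?_ ?_ ?_ ?_ ?_ ?_ ?_ ?_)))))))
  · simp [State.set, State.tick, f15]
  · simpa [State.set, State.tick, fm] using em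
  · simpa [State.set, State.tick, fm] using eb
  · simp [State.set, State.tick, fd, trialLength]; ring
  · simp [State.set, State.tick, fl, el, trialLog]
  · intro r hr
    simp [State.set, State.tick, show r ≠ 4 by omega, show r ≠ 12 by omega, show r ≠ 13 by omega,
      fr' r (by omega)]
  · rw [f14', fr' 13 (by omega)] at c
    simp [State.set, State.tick, f14', c, fr', h4]
  · simp only [State.set, State.tick]
    omega
  · simp [State.set, State.tick, f15]
  · simpa [State.set, State.tick, fm] using em
  · simpa [State.set, State.tick, fm] using eb
  · simp [State.set, State.tick, fd, trialLength]; ring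
  · simp [State.set, State.tick, fl, el, trialLog]
  · intro r hr
    simp [State.set, State.tick, show r ≠ 4 by omega, fr' r (by omega)]
  · rw [f14', fr' 13 (by omega)] at c
    simp [State.set, State.tick, c, fr']
  · simp only [State.set, State.tick]
    omega

/-- `J` trials in a row. -/
def trialsCmd : ℕ → Cmd
  | 0 => .skip
  | J + 1 => .seq (trialsCmd J) trialCmd

/-- The queries of `J` trials in a row. -/
def trialsLog (ω : ℕ → Fin n) (k : ℕ) : ℕ → List (ℕ × ℕ)
  | 0 => []
  | J + 1 => trialLog ω k (J * trialLength k) (trialsLog ω k J)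

/-- The first position among `0, …, J - 1` at which `c` is smallest, together with the value of `c`
there; only values below `b` count, and the result is `(0, b)` if there are none. -/
def firstMin (c : ℕ → ℕ) (b : ℕ) : ℕ → ℕ × ℕ
  | 0 => (0, b)
  | J + 1 => if c J < (firstMin c b J).2 then (J, c J) else firstMin c b J

theorem firstMin_spec {c : ℕ → ℕ} {b : ℕ} (hc : ∀ j, c j < b) (J : ℕ) :
    (∀ j < J, (firstMin c b J).2 ≤ c j) ∧
      (0 < J → (firstMin c b J).1 < J ∧ c (firstMin c b J).1 = (firstMin c b J).2) := by
  induction J with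
  | zero => simp
  | succ J ih =>
    rw [firstMin]
    split_ifs with h
    · refine ⟨fun j hj => ?_, fun _ => ⟨J.lt_succ_self, rfl⟩⟩
      rcases Nat.lt_succ_iff_lt_or_eq.1 hj with hj | rfl
      · exact h.le.trans (ih.1 j hj)
      · exact le_rfl
    · refine ⟨fun j hj => ?_, fun _ => ?_⟩
      · rcases Nat.lt_succ_iff_lt_or_eq.1 hj with hj | rfl
        · exact ih.1 j hj
        · exact not_lt.1 h
      · rcases Nat.eq_zero_or_pos J with rfl | hJ
        · exact absurd (hc 0) h
        · exact ⟨(ih.2 hJ).1.trans J.lt_succ_self, (ih.2 hJ).2⟩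

/-- The number of errors that trial `j` finds. -/
noncomputable def countOf (G : SimpleGraph (Fin n)) (ω : ℕ → Fin n) (k j : ℕ) : ℕ :=
  trialCount G k (stretch ω (j * trialLength k) (trialLength k))

theorem haltsWith_trialsCmd {s : State} {k b : ℕ} (J : ℕ) (h1 : s.reg 1 = k) (h3 : s.reg 3 = 1)
    (h4 : s.reg 4 = 0) (h12 : s.reg 12 = 0) (h13 : s.reg 13 = b) (h21 : s.reg 21 = 0)
    (hd : s.drawn = 0) (hl : s.log = []) :
    HaltsWith G ω (trialsCmd J) s fun s' => s'.reg 4 = J * (2 * k) ∧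
      (∀ j < J, StoresPivots G ω (j * trialLength k) k (j * (2 * k)) s'.mem) ∧
      s'.drawn = J * trialLength k ∧ s'.log = trialsLog ω k J ∧
      (∀ r, r < 4 ∨ r = 21 → s'.reg r = s.reg r) ∧
      s'.reg 12 = (firstMin (countOf G ω k) b J).1 * (2 * k) ∧
      s'.reg 13 = (firstMin (countOf G ω k) b J).2 ∧ s'.time ≤ s.time + (J * trialTime k + 1) := by
  induction J with
  | zero =>
    refine haltsWith_skip ⟨?_, fun j hj => absurd hj (Nat.not_lt_zero j), ?_, hl, fun _ _ => rfl,
      ?_, h13, ?_⟩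
    · simpa [State.tick] using h4
    · simpa [State.tick] using hd
    · simpa [State.tick, firstMin] using h12
    · simp [State.tick]
  | succ J ih =>
    refine haltsWith_seq (ih.mono ?_)
    rintro s₁ ⟨e4, em, ed, el, er, e12, e13, et⟩
    refine haltsWith_trialCmd (base := J * (2 * k)) (d := J * trialLength k) (k := k)
      ((er 1 (by omega)).trans h1) ((er 3 (by omega)).trans h3) e4
      ((er 21 (by omega)).trans h21) ed ?_
    intro s₂ f4 fm fb fd fl fr fc ft
    refine ⟨by rw [f4]; ring, ?_, by rw [fd]; ring, by rw [fl, el]; rfl,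
      fun r hr => (fr r hr).trans (er r hr), ?_, ?_, ?_⟩
    · intro j hj
      rcases Nat.lt_succ_iff_lt_or_eq.1 hj with hj | rfl
      · intro i hi
        have hlt : j * (2 * k) + 2 * k ≤ J * (2 * k) := by
          have := Nat.mul_le_mul_right (2 * k) (Nat.succ_le_of_lt hj)
          rwa [Nat.succ_mul] at this
        rw [fb _ (by omega), fb _ (by omega)]
        exact em j hj i hi
      · exact fm
    · rw [e13, e12] at fc
      have := congrArg Prod.fst fc
      simp only at this
      rw [this, firstMin, countOf]
      split_ifs <;> rfl
    · rw [e13, e12] at fc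
      have := congrArg Prod.snd fc
      simp only at this
      rw [this, firstMin, countOf]
      split_ifs <;> rfl
    · have : (J + 1) * trialTime k = J * trialTime k + trialTime k := by ring
      omega

/-- The preprocessing: all trials, one after the other.  The initial value of the smallest count is
larger than any count. -/
def preprocessCmd : Cmd :=
  block [.const 3 1, .const 21 0, .const 4 0, .const 12 0, .copy 13 1, scaleCmd 13 11,
    .add 13 13 3, trialsCmd trials]

/-- The label of the vertex in register `2` with respect to the trial with the smallest count. -/
def vertexCmd : Cmd :=
  block [.copy 4 12, .add 5 4 1, .add 5 5 1, .copy 6 2, labelCmd, .copy 0 7]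

theorem countPairs_le (g : Fin n → Fin n → Prop) (t : ℕ) :
    ∀ l : List (Fin n), l.length = 2 * t → countPairs g l ≤ t := by
  induction t with
  | zero =>
    intro l hl
    obtain rfl : l = [] := List.length_eq_zero_iff.1 (by omega)
    simp [countPairs]
  | succ t ih =>
    rintro (_ | ⟨a, _ | ⟨b, l⟩⟩) hl
    · simp at hl
    · simp at hl; omega
    · have := ih l (by simp at hl; omega)
      simp only [countPairs]
      split_ifs <;> omega

theorem countOf_lt (k j : ℕ) : countOf G ω k j < sampling * k + 1 := by
  refine Nat.lt_succ_of_le (countPairs_le _ _ _ ?_)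
  simp [trialLength]

/-- The trial whose pivots are used. -/
noncomputable def bestTrial (G : SimpleGraph (Fin n)) (k : ℕ) (ω : ℕ → Fin n) : ℕ :=
  (firstMin (countOf G ω k) (sampling * k + 1) trials).1

theorem bestTrial_lt (k : ℕ) : bestTrial G k ω < trials :=
  ((firstMin_spec (countOf_lt k) trials).2 (by decide)).1

theorem countOf_bestTrial_le (k : ℕ) {j : ℕ} (hj : j < trials) :
    countOf G ω k (bestTrial G k ω) ≤ countOf G ω k j := by
  have h := firstMin_spec (countOf_lt (G := G) (ω := ω) k) trials
  exact (h.2 (by decide)).2.trans_le (h.1 j hj)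

/-- The clustering that the programs compute. -/
noncomputable def bestClustering (G : SimpleGraph (Fin n)) (k : ℕ) (ω : ℕ → Fin n) :
    Fin n → ℕ :=
  pivotClustering G (trialPivots G k
    (stretch ω (bestTrial G k ω * trialLength k) (trialLength k)))

theorem haltsWith_preprocessCmd {s : State} {k : ℕ} (h1 : s.reg 1 = k) (hd : s.drawn = 0)
    (hl : s.log = []) :
    HaltsWith G ω preprocessCmd s fun s' => s'.reg 1 = k ∧ s'.reg 2 = s.reg 2 ∧ s'.reg 3 = 1 ∧
      s'.reg 12 = bestTrial G k ω * (2 * k) ∧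
      StoresPivots G ω (bestTrial G k ω * trialLength k) k (bestTrial G k ω * (2 * k)) s'.mem ∧
      s'.log = trialsLog ω k trials ∧ s'.time ≤ s.time + (trials * trialTime k + 20) := by
  refine haltsWith_block_cons (haltsWith_const (haltsWith_block_cons (haltsWith_const
    (haltsWith_block_cons (haltsWith_const (haltsWith_block_cons (haltsWith_const
    (haltsWith_block_cons (haltsWith_copy (haltsWith_block_cons (haltsWith_scaleCmd
    (haltsWith_block_cons (haltsWith_add (haltsWith_block_cons ?_))))))))))))))
  refine HaltsWith.mono (haltsWith_trialsCmd (k := k) (b := sampling * k + 1) trials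
    (by simp [State.set, h1]) (by simp [State.set]) (by simp [State.set]) (by simp [State.set])
    (by simp [State.set, h1]) (by simp [State.set]) hd hl) ?_
  rintro s₁ ⟨e4, em, ed, el, er, e12, e13, et⟩
  refine haltsWith_block_nil ⟨?_, ?_, ?_, e12, em _ (bestTrial_lt k), el, ?_⟩
  · change s₁.reg 1 = k
    rw [er 1 (by omega)]; simp [State.set, h1]
  · change s₁.reg 2 = s.reg 2
    rw [er 2 (by omega)]; simp [State.set]
  · change s₁.reg 3 = 1
    rw [er 3 (by omega)]; simp [State.set]
  · simp only [State.set] at et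
    simp only [State.tick]
    omega

theorem haltsWith_vertexCmd {s : State} {k : ℕ} {v : Fin n} (h1 : s.reg 1 = k)
    (h2 : s.reg 2 = v) (h3 : s.reg 3 = 1) (h12 : s.reg 12 = bestTrial G k ω * (2 * k))
    (hmem : StoresPivots G ω (bestTrial G k ω * trialLength k) k (bestTrial G k ω * (2 * k))
      s.mem) :
    HaltsWith G ω vertexCmd s fun s' =>
      s'.output = bestClustering G k ω v ∧ s'.time ≤ s.time + (14 * k + 10) := by
  refine haltsWith_block_cons (haltsWith_copy (haltsWith_block_cons (haltsWith_add
    (haltsWith_block_cons (haltsWith_add (haltsWith_block_cons (haltsWith_copy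
    (haltsWith_block_cons ?_))))))))
  refine haltsWith_labelCmd_of_stores (base := bestTrial G k ω * (2 * k))
    (d := bestTrial G k ω * trialLength k) (m := k) (x := v) (by simp [State.set, h3])
    (by simp [State.set, h12]) (by simp [State.set, h12, h1]; omega) (by simp [State.set, h2])
    hmem ?_
  intro s₁ e7 er em ed el et
  refine haltsWith_block_cons (haltsWith_copy (haltsWith_block_nil ⟨?_, ?_⟩))
  · have : trialPivots G k (stretch ω (bestTrial G k ω * trialLength k) (trialLength k))
        = pivots G [] (stretch ω (bestTrial G k ω * trialLength k) k) := by
      rw [trialPivots, trialLength, stretch_add, List.take_left' (by simp)]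
    simp [State.output, State.tick, State.set, bestClustering, pivotClustering, this, e7]
  · simp only [State.set, State.tick] at et ⊢
    omega

end Programs

/-! ### Running times in terms of the accuracy -/

theorem one_le_ceil_mul {ε : ℝ} (hε : 0 < ε) : 1 ≤ (⌈1 / ε⌉₊ : ℝ) * ε := by
  have := Nat.le_ceil (1 / ε)
  rwa [div_le_iff₀ hε] at this

theorem ceil_le {ε : ℝ} (hε : 0 < ε) (hε1 : ε < 1) : (⌈1 / ε⌉₊ : ℝ) ≤ 2 / ε := by
  have h1 := (Nat.ceil_lt_add_one (by positivity : 0 ≤ 1 / ε)).le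
  have h2 : 1 ≤ 1 / ε := by rw [le_div_iff₀ hε]; linarith
  have h3 : 2 / ε = 1 / ε + 1 / ε := by ring
  linarith

theorem preprocess_time_le {ε : ℝ} (hε : 0 < ε) (hε1 : ε < 1) :
    ((trials * trialTime ⌈1 / ε⌉₊ + 20 : ℕ) : ℝ) ≤ 10000000 / ε ^ 2 - 38 / ε := by
  have h1 := ceil_le hε hε1
  have h2 : 1 ≤ 1 / ε := by rw [le_div_iff₀ hε]; linarith
  set k : ℝ := (⌈1 / ε⌉₊ : ℝ) with hk
  have hk0 : 0 ≤ k := Nat.cast_nonneg _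
  have e1 : 10000000 / ε ^ 2 = 10000000 * (1 / ε) ^ 2 := by field_simp
  have e2 : 38 / ε = 38 * (1 / ε) := by ring
  have e3 : 2 / ε = 2 * (1 / ε) := by ring
  rw [e3] at h1
  rw [e1, e2, trialTime]
  push_cast
  rw [← hk]
  set x := 1 / ε
  have h3 : k * k ≤ (2 * x) * (2 * x) := mul_le_mul h1 h1 hk0 (by linarith)
  have h4 : x ≤ x * x := by nlinarith
  nlinarith

theorem vertex_time_le {ε : ℝ} (hε : 0 < ε) (hε1 : ε < 1) :
    ((14 * ⌈1 / ε⌉₊ + 10 : ℕ) : ℝ) ≤ 38 / ε := by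
  have h1 := ceil_le hε hε1
  have h2 : 1 ≤ 1 / ε := by rw [le_div_iff₀ hε]; linarith
  have h3 : 38 / ε = 14 * (2 / ε) + 10 * (1 / ε) := by ring
  push_cast
  linarith

theorem bestClustering_good {n : ℕ} [NeZero n] (G : SimpleGraph (Fin n)) {ε : ℝ} (hε : 0 < ε) :
    2 / 3 ≤ (tapeLaw n).real {ω | IsApproxClustering 4 ε G (bestClustering G ⌈1 / ε⌉₊ ω)} :=
  best_trial_good G hε (one_le_ceil_mul hε) (bestTrial G ⌈1 / ε⌉₊) (fun _ => bestTrial_lt _)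
    fun _ _ hj => countOf_bestTrial_le _ hj

end LocalClustering

theorem theorem3p4 :
    -- a local algorithm running in time `O(1/ε²)` per vertex
    (∃ (P : Cmd) (C : ℝ), ∀ ε : ℝ, 0 < ε → ε < 1 →
      ∀ (n : ℕ) [NeZero n] (G : SimpleGraph (Fin n)),
        ClustersLocally P ⌈1 / ε⌉₊ (C / ε ^ 2) 4 ε (2 / 3) G) ∧
    -- a local algorithm running in time `O(1/ε)` per vertex after preprocessing that takes
    -- `O(1/ε²)` time and queries; the queries depend on the random tape but not on the graph
    (∃ (Ppre P : Cmd) (C : ℝ), ∀ ε : ℝ, 0 < ε → ε < 1 →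
      ∀ (n : ℕ) [NeZero n], ∃ queries : (ℕ → Fin n) → List (ℕ × ℕ),
        ∀ G : SimpleGraph (Fin n),
          ClustersLocallyWithPreprocessing Ppre P ⌈1 / ε⌉₊ (C / ε ^ 2) (C / ε) 4 ε (2 / 3)
            queries G) ∧
    -- the lower bound on the number of adaptive queries per vertex, even after preprocessing with
    -- any number `p` of queries that does not grow with `n`
    (∀ c δ : ℝ, 1 ≤ c → 0 < δ → ∃ K ε₀ : ℝ, 0 < K ∧ 0 < ε₀ ∧
      ∀ ε : ℝ, 0 < ε → ε < ε₀ → ∀ p : ℕ, ∃ N : ℕ, ∀ n : ℕ, N ≤ n →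
        ∀ (Ω : Type) [MeasurableSpace Ω] (μ : Measure Ω) [IsProbabilityMeasure μ]
          (A : LocalQueryAlgorithm n Ω) (q : ℕ),
          A.HasQueryComplexity p q →
          (∀ (G : SimpleGraph (Fin n)) (v : Fin n), Measurable fun ω => A.label G ω v) →
          (∀ G : SimpleGraph (Fin n), δ ≤ μ.real {ω | IsApproxClustering c ε G (A.label G ω)}) →
          K / ε ≤ (q : ℝ)) := by
  refine ⟨⟨.seq preprocessCmd vertexCmd, 10000000, ?_⟩,
    ⟨preprocessCmd, vertexCmd, 10000000, ?_⟩, fun c δ _ hδ => query_lower_bound c δ hδ⟩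
  · intro ε hε hε1 n _ G
    refine ⟨bestClustering G ⌈1 / ε⌉₊, fun ω v => ?_, bestClustering_good G hε⟩
    have h : HaltsWith G ω (.seq preprocessCmd vertexCmd)
        ((State.init n ⌈1 / ε⌉₊).giveVertex v) fun s =>
        (s.time : ℝ) ≤ 10000000 / ε ^ 2 ∧ s.output = bestClustering G ⌈1 / ε⌉₊ ω v := by
      refine haltsWith_seq ((haltsWith_preprocessCmd (k := ⌈1 / ε⌉₊)
        (by simp [State.giveVertex, State.init]) rfl rfl).mono ?_)
      rintro s ⟨e1, e2, e3, e12, em, -, et⟩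
      refine (haltsWith_vertexCmd e1 (v := v) ?_ e3 e12 em).mono ?_
      · rw [e2]; simp [State.giveVertex]
      · rintro s' ⟨f1, f2⟩
        refine ⟨?_, f1⟩
        have h1 : s'.time ≤ (trials * trialTime ⌈1 / ε⌉₊ + 20) + (14 * ⌈1 / ε⌉₊ + 10) := by
          have : ((State.init n ⌈1 / ε⌉₊).giveVertex v).time = 0 := rfl
          omega
        have h2 : (s'.time : ℝ) ≤ ((trials * trialTime ⌈1 / ε⌉₊ + 20 : ℕ) : ℝ)
            + ((14 * ⌈1 / ε⌉₊ + 10 : ℕ) : ℝ) := by exact_mod_cast h1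
        linarith [preprocess_time_le hε hε1, vertex_time_le hε hε1]
    obtain ⟨s, h1, h2, h3⟩ := h
    exact ⟨s, h1, h2, h3⟩
  · intro ε hε hε1 n _
    refine ⟨fun ω => trialsLog ω ⌈1 / ε⌉₊ trials, fun G => ⟨bestClustering G ⌈1 / ε⌉₊,
      fun ω => ?_, bestClustering_good G hε⟩⟩
    obtain ⟨s, hs, e1, -, e3, e12, em, el, et⟩ :=
      haltsWith_preprocessCmd (G := G) (ω := ω) (s := State.init n ⌈1 / ε⌉₊) (k := ⌈1 / ε⌉₊)
        (by simp [State.init]) rfl rfl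
    have hinit : (State.init n ⌈1 / ε⌉₊).time = 0 := rfl
    have htime : (s.time : ℝ) ≤ 10000000 / ε ^ 2 := by
      have h1 : (s.time : ℝ) ≤ ((trials * trialTime ⌈1 / ε⌉₊ + 20 : ℕ) : ℝ) := by
        exact_mod_cast (by omega : s.time ≤ trials * trialTime ⌈1 / ε⌉₊ + 20)
      have : 0 < 38 / ε := by positivity
      linarith [preprocess_time_le hε hε1]
    refine ⟨s, hs, htime, ?_, el, fun v => ?_⟩
    · have h1 := hs.log_length_le
      have h2 : (State.init n ⌈1 / ε⌉₊).log.length = 0 := rfl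
      have h3 : (s.log.length : ℝ) ≤ s.time := by exact_mod_cast (by omega)
      exact h3.trans htime
    · obtain ⟨s', hs', f1, f2⟩ := haltsWith_vertexCmd (G := G) (ω := ω) (s := s.giveVertex v)
        (k := ⌈1 / ε⌉₊) (v := v) (by simpa [State.giveVertex] using e1)
        (by simp [State.giveVertex]) (by simpa [State.giveVertex] using e3)
        (by simpa [State.giveVertex] using e12) em
      refine ⟨s', hs', ?_, f1⟩
      have h1 : (s'.time : ℝ) ≤ ((14 * ⌈1 / ε⌉₊ + 10 : ℕ) : ℝ) := by
        have : (s.giveVertex v).time = 0 := rfl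
        exact_mod_cast (by omega : s'.time ≤ 14 * ⌈1 / ε⌉₊ + 10)
      have h2 : 38 / ε ≤ 10000000 / ε := by gcongr; norm_num
      linarith [vertex_time_le hε hε1]
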